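/- Work on $[0,\infty)$ with Lebesgue measure $\lambda$. Let $M$ be the set of measurable extended complex-valued functions on $[0,\infty)$ (functions equal a.e. being identified), and $M_+$ the set of measurable functions with values in $[0,\infty]$. For $f\in M$ let $\lambda_f(s)=\lambda(\{|f|>s\})$ for $s\ge 0$ be its distribution function and $f^*(t)=\inf\{s\in[0,\infty):\lambda_f(s)\le t\}$ for $t\ge0$ its non-increasing rearrangement. A functional $\|\cdot\|:M\to[0,\infty]$ with $\|\,|f|\,\|=\|f\|$ for all $f\in M$ is a *Banach function norm* if on $M_+$ it satisfies - (P1) $\|af\|=|a|\|f\|$ for $a\in\mathbb C$; $\|f\|=0$ iff $f=0$ a.e.; $\|f+g\|\le\|f\|+\|g\|$; - (P2) $f\le g$ a.e. implies $\|f\|\le\|g\|$; - (P3) $f_n\uparrow f$ a.e. implies $\|f_n\|\uparrow\|f\|$; - (P4) $\|\chi_E\|<\infty$ whenever $\lambda(E)<\infty$; - (P5) whenever $\lambda(E)<\infty$ there is a finite constant $C_E$ such that $\int_E f\,d\lambda\le C_E\|f\|$ for all $f\in M_+$. It is a *quasi-Banach function norm* if on $M_+$ it satisfies (P2), (P3),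 (P4) and (P1) with the triangle inequality weakened to $\|f+g\|\le C(\|f\|+\|g\|)$ for some constant $C\ge1$. It is *rearrangement-invariant* (r.i.) if $\|f\|=\|g\|$ whenever $\lambda_f=\lambda_g$. Two functionals $N_1,N_2$ on $M$ are *equivalent* if there is $C\in(0,\infty)$ with $C^{-1}N_1(f)\le N_2(f)\le C\,N_1(f)$ for all $f\in M$. For $p,q\in[1,\infty]$ and $f\in M$ let $$\|f\|_{W(L^p,l^q)}=\Big(\sum_{n=0}^\infty\|f\chi_{[n,n+1)}\|_{L^p}^q\Big)^{1/q}\ (q<\infty),\qquad \|f\|_{W(L^p,l^\infty)}=\sup_{n\in\mathbb N}\|f\chi_{[n,n+1)}\|_{L^p},$$ $$\|f\|_{WL(L^p,L^q)}=\|f^*\chi_{[0,1]}\|_{L^p}+\|f^*\chi_{(1,\infty)}\|_{L^q}.$$ **Statement.** Let $p,q\in[1,\infty]$. 1. The functional $f\mapsto\|f^*\|_{W(L^p,l^q)}$ is an r.i. quasi-Banach function norm, and it is equivalent to $\|\cdot\|_{WL(L^p,L^q)}$. 2. If $q<p$, then $\|\cdot\|_{W(L^p,l^q)}$ does not satisfy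 (P4). If $p<q$, then $\|\cdot\|_{W(L^p,l^q)}$ does not satisfy (P5). Consequently $\|\cdot\|_{W(L^p,l^q)}$ is a Banach function norm if and only if $p=q$. 3. $\|\cdot\|_{W(L^p,l^q)}$ is equivalent to a rearrangement-invariant norm if and only if $p=q$. This holds both when "norm" means a functional $M\to[0,\infty]$ with $\|\,|f|\,\|=\|f\|$ that satisfies (P1), and when it means a Banach function norm. 4. If $p=q$, then $\|f\|_{W(L^p,l^p)}=\|f\|_{L^p}$ for all $f\in M$. -/

import Mathlib

open MeasureTheory Filter Topology
open scoped NNReal ENNReal OnePoint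

namespace WienerLuxemburg

/-- Lebesgue measure on the half-line `[0, ∞)`. -/
noncomputable def lam : Measure ℝ≥0 :=
  Measure.comap (fun t : ℝ≥0 => (t : ℝ)) volume

/-! ### Extended complex numbers and the class `M` -/

/-- Extended complex numbers: `ℂ` together with a point at infinity. -/
abbrev ExtComplex : Type := OnePoint ℂ

noncomputable instance : MeasurableSpace ExtComplex := borel ExtComplex

instance : BorelSpace ExtComplex := ⟨rfl⟩

/-- The modulus of an extended complex number, with `|∞| = ∞`. -/
noncomputable def modulus (z : ExtComplex) : ℝ≥0∞ :=
  z.elim ⊤ (fun w : ℂ => ‖w‖ₑ)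

/-- The inclusion of `[0, ∞]` in the extended complex numbers. -/
noncomputable def ofNonneg (x : ℝ≥0∞) : ExtComplex :=
  if x = ⊤ then ∞ else (((x.toReal : ℝ) : ℂ) : ExtComplex)

/-- Multiplication of an extended complex number by a complex number,
with `0 · ∞ = 0` and `a · ∞ = ∞` for `a ≠ 0`. -/
noncomputable def scale (a : ℂ) (z : ExtComplex) : ExtComplex :=
  z.elim (if a = 0 then ((0 : ℂ) : ExtComplex) else ∞) (fun w : ℂ => ((a * w : ℂ) : ExtComplex))

/-- Membership in `M = M([0, ∞), λ)`: Lebesgue measurable extended complex-valued functions.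
Functions that agree almost everywhere are not identified; instead, the lattice property (P2)
and rearrangement invariance each force a functional to respect equality almost everywhere. -/
def MemM (f : ℝ≥0 → ExtComplex) : Prop := AEMeasurable f lam

/-- Functionals on `M` with values in `[0, ∞]` (only the values on members of `M` matter). -/
abbrev Functional : Type := (ℝ≥0 → ExtComplex) → ℝ≥0∞

/-- A `[0, ∞]`-valued function as an extended complex-valued function. -/
noncomputable def lift (f : ℝ≥0 → ℝ≥0∞) : ℝ≥0 → ExtComplex := fun t => ofNonneg (f t)

/-- The pointwise modulus of an extended complex-valued function. -/
noncomputable def absFun (f : ℝ≥0 → ExtComplex) : ℝ≥0 → ℝ≥0∞ := fun t => modulus (f t)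

/-! ### Non-increasing rearrangement -/

/-- The distribution function of `f`. -/
noncomputable def distribution (f : ℝ≥0 → ExtComplex) (s : ℝ≥0) : ℝ≥0∞ :=
  lam {t : ℝ≥0 | (s : ℝ≥0∞) < absFun f t}

/-- The non-increasing rearrangement `f*` of `f`
(the infimum is taken in `[0, ∞]`, so it is `∞` over the empty set). -/
noncomputable def rearrangement (f : ℝ≥0 → ExtComplex) (t : ℝ≥0) : ℝ≥0∞ :=
  ⨅ (s : ℝ≥0) (_ : distribution f s ≤ (t : ℝ≥0∞)), (s : ℝ≥0∞)

/-- Two functions are equimeasurable if their distribution functions coincide. -/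
def Equimeasurable (f g : ℝ≥0 → ExtComplex) : Prop :=
  ∀ s : ℝ≥0, distribution f s = distribution g s

/-! ### Axioms of (quasi-)Banach function norms -/

/-- `‖ |f| ‖ = ‖f‖` for all `f ∈ M`. -/
def AbsInvariant (N : Functional) : Prop :=
  ∀ f : ℝ≥0 → ExtComplex, MemM f → N (lift (absFun f)) = N f

/-- Positive homogeneity on `M₊`. -/
def Homogeneous (N : Functional) : Prop :=
  ∀ (a : ℂ) (f : ℝ≥0 → ℝ≥0∞), AEMeasurable f lam →
    N (fun t => scale a (ofNonneg (f t))) = ‖a‖ₑ * N (lift f)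

/-- `‖f‖ = 0` if and only if `f = 0` almost everywhere, on `M₊`. -/
def Definite (N : Functional) : Prop :=
  ∀ f : ℝ≥0 → ℝ≥0∞, AEMeasurable f lam → (N (lift f) = 0 ↔ ∀ᵐ t ∂lam, f t = 0)

/-- Axiom (P1): `N` is a norm on `M₊`. -/
structure AxiomP1 (N : Functional) : Prop where
  homogeneous : Homogeneous N
  definite : Definite N
  subadditive : ∀ f g : ℝ≥0 → ℝ≥0∞, AEMeasurable f lam → AEMeasurable g lam →
    N (lift (fun t => f t + g t)) ≤ N (lift f) + N (lift g)

/-- Axiom (Q1): `N` is a quasinorm on `M₊`. -/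
structure AxiomQ1 (N : Functional) : Prop where
  homogeneous : Homogeneous N
  definite : Definite N
  quasi_subadditive : ∃ C : ℝ≥0, 1 ≤ C ∧
    ∀ f g : ℝ≥0 → ℝ≥0∞, AEMeasurable f lam → AEMeasurable g lam →
      N (lift (fun t => f t + g t)) ≤ (C : ℝ≥0∞) * (N (lift f) + N (lift g))

/-- Axiom (P2): the lattice property. -/
def AxiomP2 (N : Functional) : Prop :=
  ∀ f g : ℝ≥0 → ℝ≥0∞, AEMeasurable f lam → AEMeasurable g lam →
    (∀ᵐ t ∂lam, f t ≤ g t) → N (lift f) ≤ N (lift g)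

/-- Axiom (P3): the Fatou property. -/
def AxiomP3 (N : Functional) : Prop :=
  ∀ (F : ℕ → ℝ≥0 → ℝ≥0∞) (f : ℝ≥0 → ℝ≥0∞),
    (∀ n, AEMeasurable (F n) lam) → AEMeasurable f lam →
    (∀ᵐ t ∂lam, Monotone (fun n => F n t) ∧ Tendsto (fun n => F n t) atTop (𝓝 (f t))) →
    Monotone (fun n => N (lift (F n))) ∧
      Tendsto (fun n => N (lift (F n))) atTop (𝓝 (N (lift f)))

/-- Axiom (P4): characteristic functions of sets of finite measure have finite norm. -/
def AxiomP4 (N : Functional) : Prop :=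
  ∀ E : Set ℝ≥0, NullMeasurableSet E lam → lam E < ⊤ →
    N (lift (E.indicator (fun _ => 1))) < ⊤

/-- Axiom (P5): local integrability, controlled by the norm, over sets of finite measure. -/
def AxiomP5 (N : Functional) : Prop :=
  ∀ E : Set ℝ≥0, NullMeasurableSet E lam → lam E < ⊤ →
    ∃ C : ℝ≥0, ∀ f : ℝ≥0 → ℝ≥0∞, AEMeasurable f lam →
      ∫⁻ t in E, f t ∂lam ≤ (C : ℝ≥0∞) * N (lift f)

/-- Banach function norms. -/
structure IsBanachFunctionNorm (N : Functional) : Prop where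
  abs_invariant : AbsInvariant N
  p1 : AxiomP1 N
  p2 : AxiomP2 N
  p3 : AxiomP3 N
  p4 : AxiomP4 N
  p5 : AxiomP5 N

/-- Quasi-Banach function norms. -/
structure IsQuasiBanachFunctionNorm (N : Functional) : Prop where
  abs_invariant : AbsInvariant N
  q1 : AxiomQ1 N
  p2 : AxiomP2 N
  p3 : AxiomP3 N
  p4 : AxiomP4 N

/-- Rearrangement invariance. -/
def RearrangementInvariant (N : Functional) : Prop :=
  ∀ f g : ℝ≥0 → ExtComplex, MemM f → MemM g → Equimeasurable f g → N f = N g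

/-- Equivalence of functionals on `M`. -/
def EquivalentFunctionals (N₁ N₂ : Functional) : Prop :=
  ∃ C : ℝ≥0, 0 < C ∧ ∀ f : ℝ≥0 → ExtComplex, MemM f →
    (C : ℝ≥0∞)⁻¹ * N₁ f ≤ N₂ f ∧ N₂ f ≤ (C : ℝ≥0∞) * N₁ f

/-! ### Lebesgue, Wiener and Wiener–Luxemburg functionals -/

/-- The classical Lebesgue functional `‖f‖_p`. -/
noncomputable def lebesgueNorm (p : ℝ≥0∞) : Functional :=
  fun f => eLpNorm (absFun f) p lam

/-- The Wiener amalgam functional `‖f‖_{W(L^p, l^q)}`. -/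
noncomputable def wienerNorm (p q : ℝ≥0∞) : Functional :=
  fun f =>
    if q = ⊤ then
      ⨆ n : ℕ, lebesgueNorm p (lift ((Set.Ico (n : ℝ≥0) (n + 1)).indicator (absFun f)))
    else
      (∑' n : ℕ, lebesgueNorm p
        (lift ((Set.Ico (n : ℝ≥0) (n + 1)).indicator (absFun f))) ^ q.toReal) ^ (1 / q.toReal)

/-- The functional `f ↦ N (f*)`. -/
noncomputable def rearranged (N : Functional) : Functional :=
  fun f => N (lift (rearrangement f))

/-- The Wiener–Luxemburg functional
`‖f‖_{WL(A, B)} = ‖f* χ_{[0, 1]}‖_A + ‖f* χ_{(1, ∞)}‖_B`. -/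
noncomputable def wienerLuxemburg (A B : Functional) : Functional :=
  fun f => A (lift ((Set.Icc 0 1).indicator (rearrangement f))) +
    B (lift ((Set.Ioi 1).indicator (rearrangement f)))

end WienerLuxemburg

open WienerLuxemburg

/-!
The amalgam functional is a mixed norm: the `l^q` norm of the `L^p` norms over the unit cells.

Since `(f + g)*(t) ≤ f*(t / 2) + g*(t / 2)`, the functional `f ↦ N (f*)` inherits the quasi-triangle
inequality from `N` as soon as the dilation by two is bounded, and it is bounded because it maps
every cell into a cell, at most two cells into the same one. On a non-increasing function the `L^p`
norm over a cell lies between the values at its end points, so all cells except the first are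
blind to `p`; this compares `‖f*‖_{W(L^p, l^q)}` with the Wiener–Luxemburg functional.

A step function with one interval of length `(n + 1)^(-r)` and height `(n + 1)^s` in each cell has
amalgam norm `‖((n + 1)^(s - r / p))_n‖_{l^q}`. For `q < p` and `r > 1` close to `1` this makes the
indicator of a set of finite measure have infinite norm, and for `p < q` it gives a function of
finite norm, supported in a set of finite measure, that is not integrable, or not in `L^p`.
A rearrangement-invariant functional equivalent to the amalgam functional is finite on a function
supported in a set of finite measure exactly when it is finite on `f*`, whose support is bounded,
hence exactly when `f ∈ L^p`; both step functions contradict this unless `p = q`.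
-/

namespace WienerLuxemburg

/-! ### Extended complex numbers -/

@[simp] lemma modulus_coe (w : ℂ) : modulus (w : ExtComplex) = ‖w‖ₑ := rfl

@[simp] lemma modulus_infty : modulus (∞ : ExtComplex) = ⊤ := rfl

@[simp] lemma modulus_ofNonneg (x : ℝ≥0∞) : modulus (ofNonneg x) = x := by
  unfold ofNonneg
  split_ifs with h
  · rw [h, modulus_infty]
  · rw [modulus_coe, ← ofReal_norm, Complex.norm_real, Real.norm_of_nonneg ENNReal.toReal_nonneg,
      ENNReal.ofReal_toReal h]

@[simp] lemma absFun_lift (g : ℝ≥0 → ℝ≥0∞) : absFun (lift g) = g :=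
  funext fun _ => modulus_ofNonneg _

lemma modulus_scale (a : ℂ) (z : ExtComplex) : modulus (scale a z) = ‖a‖ₑ * modulus z := by
  induction z using OnePoint.rec with
  | infty =>
    change modulus (if a = 0 then ((0 : ℂ) : ExtComplex) else ∞) = ‖a‖ₑ * ⊤
    split_ifs with h
    · simp [h]
    · rw [modulus_infty, ENNReal.mul_top (by simpa using h)]
  | coe w =>
    change modulus ((a * w : ℂ) : ExtComplex) = ‖a‖ₑ * ‖w‖ₑ
    rw [modulus_coe, enorm_mul]

lemma absFun_scale (a : ℂ) (g : ℝ≥0 → ℝ≥0∞) :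
    absFun (fun t => scale a (ofNonneg (g t))) = fun t => ‖a‖ₑ * g t := by
  funext t
  rw [absFun, modulus_scale, modulus_ofNonneg]

lemma ofNonneg_coe_mul (r : ℝ≥0) (x : ℝ≥0∞) :
    ofNonneg (r * x) = scale ((r : ℝ) : ℂ) (ofNonneg x) := by
  induction x with
  | top =>
    rcases eq_or_ne r 0 with rfl | hr
    · simp [ofNonneg, scale]
    · simp [ofNonneg, scale, ENNReal.mul_top, hr]
  | coe x => simp [ofNonneg, scale, ← ENNReal.coe_mul]

lemma continuous_modulus : Continuous modulus := by
  rw [OnePoint.continuous_iff]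
  refine ⟨?_, by simpa [Function.comp_def] using continuous_enorm⟩
  rw [modulus_infty, coclosedCompact_eq_cocompact]
  simpa using (ENNReal.tendsto_ofReal_nhds_top.2 (tendsto_norm_cocompact_atTop (E := ℂ))).congr
    fun w => ofReal_norm w

lemma measurable_ofNonneg : Measurable ofNonneg := by
  unfold ofNonneg
  refine Measurable.ite (measurableSet_singleton _) measurable_const ?_
  exact OnePoint.continuous_coe.measurable.comp
    (Complex.continuous_ofReal.measurable.comp ENNReal.measurable_toReal)

lemma MemM.aemeasurable_absFun {f : ℝ≥0 → ExtComplex} (hf : MemM f) :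
    AEMeasurable (absFun f) lam :=
  continuous_modulus.measurable.comp_aemeasurable hf

lemma memM_lift {g : ℝ≥0 → ℝ≥0∞} (hg : AEMeasurable g lam) : MemM (lift g) :=
  measurable_ofNonneg.comp_aemeasurable hg

/-! ### Lebesgue measure on the half-line -/

lemma measurableEmbedding_coe : MeasurableEmbedding (fun t : ℝ≥0 => (t : ℝ)) :=
  MeasurableEmbedding.subtype_coe measurableSet_Ici

lemma lam_apply (s : Set ℝ≥0) : lam s = volume ((fun t : ℝ≥0 => (t : ℝ)) '' s) :=
  measurableEmbedding_coe.comap_apply _ _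

lemma lam_Ico (a b : ℝ≥0) : lam (Set.Ico a b) = ((b - a : ℝ≥0) : ℝ≥0∞) := by
  rw [lam_apply]
  refine (congrArg volume (NNReal.image_coe_Ico a b)).trans ?_
  rw [Real.volume_Ico, ENNReal.ofReal, NNReal.sub_def]

lemma lam_Iio (a : ℝ≥0) : lam (Set.Iio a) = a := by
  rw [← Set.Ico_bot, bot_eq_zero, lam_Ico, tsub_zero]

instance : IsFiniteMeasureOnCompacts lam :=
  .comap' _ NNReal.continuous_coe measurableEmbedding_coe

instance : NullSingletonClass lam := ⟨fun x => by simp [lam_apply]⟩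

lemma lam_setOf_coe_lt (x : ℝ≥0∞) : lam {t : ℝ≥0 | (t : ℝ≥0∞) < x} = x := by
  have lam_coe (a : ℝ≥0) : lam {t : ℝ≥0 | (t : ℝ≥0∞) < a} = a := by
    simp only [ENNReal.coe_lt_coe]
    exact lam_Iio a
  induction x with
  | coe a => exact lam_coe a
  | top =>
    refine ENNReal.eq_top_of_forall_nnreal_le fun r => ?_
    rw [← lam_coe r]
    exact measure_mono fun t _ => ENNReal.coe_lt_top

lemma map_half_lam : lam.map (fun t : ℝ≥0 => t / 2) = (2 : ℝ≥0∞) • lam := by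
  ext s hs
  have image_preimage : (fun t : ℝ≥0 => (t : ℝ)) '' ((fun t : ℝ≥0 => t / 2) ⁻¹' s) =
      (fun x : ℝ => (2 : ℝ) • x) '' ((fun t : ℝ≥0 => (t : ℝ)) '' s) := by
    ext x
    simp only [Set.mem_image, Set.mem_preimage, exists_exists_and_eq_and, smul_eq_mul]
    constructor
    · rintro ⟨t, ht, rfl⟩
      exact ⟨t / 2, ht, by push_cast; ring⟩
    · rintro ⟨t, ht, rfl⟩
      exact ⟨2 * t, by simpa using ht, by push_cast; ring⟩
  rw [Measure.map_apply (by fun_prop) hs, Measure.smul_apply, lam_apply, lam_apply, image_preimage,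
    Set.image_smul, Measure.addHaar_smul]
  simp

/-! ### Lebesgue norms of `[0, ∞]`-valued functions -/

section eLpNorm

variable {α β : Type*} [MeasurableSpace α] [MeasurableSpace β] {μ : Measure α} {ν : Measure β}

lemma eLpNorm_eq_lintegral_rpow {p : ℝ≥0∞} (hp0 : p ≠ 0) (hp : p ≠ ⊤) (g : α → ℝ≥0∞) :
    eLpNorm g p μ = (∫⁻ t, g t ^ p.toReal ∂μ) ^ (1 / p.toReal) := by
  simp only [eLpNorm_eq_lintegral_rpow_enorm_toReal hp0 hp, enorm_eq_self]

lemma eLpNorm_top_eq_essSup (g : α → ℝ≥0∞) : eLpNorm g ⊤ μ = essSup g μ := by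
  simp only [eLpNorm_exponent_top, eLpNormEssSup, enorm_eq_self]

lemma eLpNorm_const_mul_ennreal {c : ℝ≥0∞} (hc : c ≠ ⊤) (g : α → ℝ≥0∞) (p : ℝ≥0∞) :
    eLpNorm (fun t => c * g t) p μ = c * eLpNorm g p μ := by
  rcases eq_or_ne p 0 with rfl | hp0
  · simp
  rcases eq_or_ne p ⊤ with rfl | hp
  · simpa only [eLpNorm_top_eq_essSup] using ENNReal.essSup_const_mul
  have hr : 0 < p.toReal := ENNReal.toReal_pos hp0 hp
  simp only [eLpNorm_eq_lintegral_rpow hp0 hp, ENNReal.mul_rpow_of_nonneg _ _ hr.le]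
  rw [lintegral_const_mul' _ _ (ENNReal.rpow_ne_top_of_nonneg hr.le hc),
    ENNReal.mul_rpow_of_nonneg _ _ (by positivity), one_div, ENNReal.rpow_rpow_inv hr.ne']

lemma eLpNorm_const_of_isProbabilityMeasure [IsProbabilityMeasure μ] {p : ℝ≥0∞} (hp : p ≠ 0)
    (c : ℝ≥0∞) : eLpNorm (fun _ => c) p μ = c := by
  rw [eLpNorm_const _ hp (NeZero.ne _), measure_univ, ENNReal.one_rpow, mul_one, enorm_eq_self]

lemma eLpNorm_indicator_one_lt_top {E : Set α} (hE : μ E < ⊤) (p : ℝ≥0∞) :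
    eLpNorm (E.indicator fun _ => (1 : ℝ≥0∞)) p μ < ⊤ := by
  refine (eLpNorm_indicator_const_le _ _).trans_lt ?_
  rw [enorm_eq_self, one_mul]
  exact ENNReal.rpow_lt_top_of_nonneg (by positivity) hE.ne

lemma eLpNorm_iSup_of_monotone {F : ℕ → α → ℝ≥0∞} {g : α → ℝ≥0∞}
    (hF : ∀ n, AEMeasurable (F n) μ)
    (h : ∀ᵐ t ∂μ, Monotone (fun n => F n t) ∧ ⨆ n, F n t = g t) (p : ℝ≥0∞) :
    ⨆ n, eLpNorm (F n) p μ = eLpNorm g p μ := by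
  refine le_antisymm (iSup_le fun n => eLpNorm_mono_enorm_ae ?_) ?_
  · filter_upwards [h] with t ht
    simpa [← ht.2] using le_iSup (fun n => F n t) n
  rcases eq_or_ne p 0 with rfl | hp0
  · simp
  rcases eq_or_ne p ⊤ with rfl | hp
  · simp only [eLpNorm_top_eq_essSup]
    refine essSup_le_of_ae_le _ ?_
    filter_upwards [ae_all_iff.2 fun n => ae_le_essSup (f := F n) (μ := μ), h] with t hle ht
    exact ht.2 ▸ iSup_mono hle
  have hr : 0 < p.toReal := ENNReal.toReal_pos hp0 hp
  have lintegral_rpow : ∫⁻ t, g t ^ p.toReal ∂μ = ⨆ n, ∫⁻ t, F n t ^ p.toReal ∂μ := by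
    rw [← lintegral_iSup' (fun n => (hF n).pow_const _)]
    · refine lintegral_congr_ae ?_
      filter_upwards [h] with t ht
      exact ht.2 ▸ (ENNReal.orderIsoRpow _ hr).map_iSup _
    · filter_upwards [h] with t ht m n hmn
      exact ENNReal.rpow_le_rpow (ht.1 hmn) hr.le
  simp only [eLpNorm_eq_lintegral_rpow hp0 hp, lintegral_rpow]
  exact ((ENNReal.orderIsoRpow _ (one_div_pos.2 hr)).map_iSup _).le

lemma eLpNorm_comp_le_of_map_le {φ : α → β} (hφ : Measurable φ) {h : β → ℝ≥0∞}
    (hh : Measurable h) {c : ℝ≥0∞} (hc : c ≠ 0) (hmap : μ.map φ ≤ c • ν) (p : ℝ≥0∞) :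
    eLpNorm (h ∘ φ) p μ ≤ c ^ (1 / p).toReal * eLpNorm h p ν :=
  calc eLpNorm (h ∘ φ) p μ
      = eLpNorm h p (μ.map φ) :=
        (eLpNorm_map_measure hh.aestronglyMeasurable hφ.aemeasurable).symm
    _ ≤ eLpNorm h p (c • ν) := eLpNorm_mono_measure _ hmap
    _ = c ^ (1 / p).toReal * eLpNorm h p ν := eLpNorm_smul_measure_of_ne_zero hc h p ν

lemma lintegral_eq_lintegral_measure_lt [SFinite μ] {g : α → ℝ≥0∞} (hg : AEMeasurable g μ) :
    ∫⁻ t, g t ∂μ = ∫⁻ s, μ {t | (s : ℝ≥0∞) < g t} ∂lam := by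
  wlog hm : Measurable g generalizing g
  · rw [lintegral_congr_ae hg.ae_eq_mk, this hg.measurable_mk.aemeasurable hg.measurable_mk]
    refine lintegral_congr fun s => measure_congr ?_
    filter_upwards [hg.ae_eq_mk] with t ht
    change ((s : ℝ≥0∞) < hg.mk g t) = (s < g t)
    rw [ht]
  have hS : MeasurableSet {x : α × ℝ≥0 | (x.2 : ℝ≥0∞) < g x.1} :=
    measurableSet_lt (by fun_prop) (by fun_prop)
  have tonelli := (Measure.prod_apply (μ := μ) (ν := lam) hS).symm.trans
    (Measure.prod_apply_symm hS)
  simpa only [Set.preimage_ofPred_eq, lam_setOf_coe_lt] using tonelli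

lemma eLpNorm_eq_of_measure_lt_eq [SFinite μ] [SFinite ν] {g : α → ℝ≥0∞} {h : β → ℝ≥0∞}
    (hg : AEMeasurable g μ) (hh : AEMeasurable h ν)
    (hd : ∀ s : ℝ≥0, μ {t | (s : ℝ≥0∞) < g t} = ν {t | (s : ℝ≥0∞) < h t}) (p : ℝ≥0∞) :
    eLpNorm g p μ = eLpNorm h p ν := by
  rcases eq_or_ne p 0 with rfl | hp0
  · simp
  rcases eq_or_ne p ⊤ with rfl | hp
  · simp only [eLpNorm_top_eq_essSup, essSup_eq_sInf]
    congr 1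
    ext a
    induction a with
    | coe s => simp [hd]
    | top => simp
  have hr : 0 < p.toReal := ENNReal.toReal_pos hp0 hp
  have lt_rpow_iff (s : ℝ≥0) (x : ℝ≥0∞) :
      (s : ℝ≥0∞) < x ^ p.toReal ↔ ((s ^ (1 / p.toReal) : ℝ≥0) : ℝ≥0∞) < x := by
    rw [ENNReal.coe_rpow_of_nonneg _ (one_div_pos.2 hr).le, one_div, ENNReal.rpow_inv_lt_iff hr]
  rw [eLpNorm_eq_lintegral_rpow hp0 hp, eLpNorm_eq_lintegral_rpow hp0 hp,
    lintegral_eq_lintegral_measure_lt (hg.pow_const _),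
    lintegral_eq_lintegral_measure_lt (hh.pow_const _)]
  simp only [lt_rpow_iff, hd]

lemma eLpNorm_count_lt_top_iff_of_finite_support [MeasurableSingletonClass α] {b : α → ℝ≥0∞}
    (hb : b.support.Finite) {q : ℝ≥0∞} (hq : q ≠ 0) :
    eLpNorm b q Measure.count < ⊤ ↔ ∀ i, b i < ⊤ := by
  refine ⟨fun h i => (enorm_le_eLpNorm_count b i hq).trans_lt h, fun h => ?_⟩
  set B := hb.toFinset.sup b
  have hBtop : B < ⊤ := (Finset.sup_lt_iff (by simp)).2 fun i _ => h i
  have hle : ∀ i, ‖b i‖ₑ ≤ ‖B * b.support.indicator (fun _ => (1 : ℝ≥0∞)) i‖ₑ := fun i => by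
    by_cases hi : i ∈ b.support
    · simpa [hi] using Finset.le_sup (f := b) (hb.mem_toFinset.2 hi)
    · simp [Function.notMem_support.1 hi]
  refine (eLpNorm_mono_enorm hle).trans_lt ?_
  rw [eLpNorm_const_mul_ennreal hBtop.ne]
  exact ENNReal.mul_lt_top hBtop (eLpNorm_indicator_one_lt_top (Measure.count_apply_lt_top.2 hb) q)

end eLpNorm

/-! ### Mixed norms over a countable family of measures -/

section mixedNorm

variable {α β ι κ : Type*} [MeasurableSpace α] [MeasurableSpace β] [MeasurableSpace ι]
  [MeasurableSpace κ]

/-- The mixed norm `‖(‖g‖_{L^p(μ i)})_i‖_{l^q}`; the Wiener amalgam functional is the case in which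
the `μ i` are the restrictions of Lebesgue measure to the unit cells `[n, n + 1)`. -/
noncomputable def mixedNorm (μ : ι → Measure α) (p q : ℝ≥0∞) (g : α → ℝ≥0∞) : ℝ≥0∞ :=
  eLpNorm (fun i => eLpNorm g p (μ i)) q Measure.count

variable {μ : ι → Measure α} {p q : ℝ≥0∞} {g h : α → ℝ≥0∞}

lemma mixedNorm_const_mul {c : ℝ≥0∞} (hc : c ≠ ⊤) (g : α → ℝ≥0∞) :
    mixedNorm μ p q (fun t => c * g t) = c * mixedNorm μ p q g := by
  simp only [mixedNorm, eLpNorm_const_mul_ennreal hc]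

lemma eLpNorm_le_mixedNorm [MeasurableSingletonClass ι] (hq : q ≠ 0) (i : ι) :
    eLpNorm g p (μ i) ≤ mixedNorm μ p q g :=
  enorm_le_eLpNorm_count (fun i => eLpNorm g p (μ i)) i hq

variable [Countable ι]

lemma mixedNorm_mono (hgh : ∀ᵐ t ∂Measure.sum μ, g t ≤ h t) :
    mixedNorm μ p q g ≤ mixedNorm μ p q h :=
  eLpNorm_mono_enorm fun i => eLpNorm_mono_enorm_ae (Measure.ae_sum_iff.1 hgh i)

variable [MeasurableSingletonClass ι]

lemma mixedNorm_eq_zero_iff (hp : p ≠ 0) (hq : q ≠ 0) (hg : AEMeasurable g (Measure.sum μ)) :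
    mixedNorm μ p q g = 0 ↔ ∀ᵐ t ∂Measure.sum μ, g t = 0 := by
  rw [mixedNorm, eLpNorm_eq_zero_iff (measurable_of_countable _).aestronglyMeasurable hq,
    EventuallyEq, Measure.ae_count_iff, Measure.ae_sum_iff]
  exact forall_congr' fun i =>
    eLpNorm_eq_zero_iff (aemeasurable_sum_measure_iff.1 hg i).aestronglyMeasurable hp

lemma mixedNorm_add_le (hg : AEMeasurable g (Measure.sum μ)) (hh : AEMeasurable h (Measure.sum μ)) :
    mixedNorm μ p q (fun t => g t + h t) ≤
      p.LpAddConst * q.LpAddConst * (mixedNorm μ p q g + mixedNorm μ p q h) :=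
  calc mixedNorm μ p q (fun t => g t + h t)
      ≤ eLpNorm (fun i => p.LpAddConst * (eLpNorm g p (μ i) + eLpNorm h p (μ i))) q
          Measure.count :=
        eLpNorm_mono_enorm fun i =>
          eLpNorm_add_le' (aemeasurable_sum_measure_iff.1 hg i).aestronglyMeasurable
            (aemeasurable_sum_measure_iff.1 hh i).aestronglyMeasurable p
    _ = p.LpAddConst * eLpNorm (fun i => eLpNorm g p (μ i) + eLpNorm h p (μ i)) q
          Measure.count :=
        eLpNorm_const_mul_ennreal p.LpAddConst_lt_top.ne _ q
    _ ≤ p.LpAddConst * (q.LpAddConst * (mixedNorm μ p q g + mixedNorm μ p q h)) := by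
        gcongr
        exact eLpNorm_add_le' (measurable_of_countable _).aestronglyMeasurable
          (measurable_of_countable _).aestronglyMeasurable q
    _ = _ := (mul_assoc _ _ _).symm

lemma mixedNorm_iSup_of_monotone {F : ℕ → α → ℝ≥0∞}
    (hF : ∀ n, AEMeasurable (F n) (Measure.sum μ))
    (h : ∀ᵐ t ∂Measure.sum μ, Monotone (fun n => F n t) ∧ ⨆ n, F n t = g t) :
    ⨆ n, mixedNorm μ p q (F n) = mixedNorm μ p q g := by
  have h' := Measure.ae_sum_iff.1 h
  refine eLpNorm_iSup_of_monotone (fun _ => (measurable_of_countable _).aemeasurable)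
    (ae_of_all _ fun i => ⟨fun m n hmn => ?_, ?_⟩) q
  · refine eLpNorm_mono_enorm_ae ?_
    filter_upwards [h' i] with t ht using ht.1 hmn
  · exact eLpNorm_iSup_of_monotone (fun n => aemeasurable_sum_measure_iff.1 (hF n) i) (h' i) p

lemma mixedNorm_self (μ : ι → Measure α) (p : ℝ≥0∞) (g : α → ℝ≥0∞) :
    mixedNorm μ p p g = eLpNorm g p (Measure.sum μ) := by
  rcases eq_or_ne p 0 with rfl | hp0
  · simp [mixedNorm]
  rcases eq_or_ne p ⊤ with rfl | hp
  · simp only [mixedNorm, eLpNorm_top_eq_essSup, essSup_count]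
    refine le_antisymm (iSup_le fun i => ?_) (essSup_le_of_ae_le _ ?_)
    · exact essSup_mono_measure (Measure.le_sum μ i).absolutelyContinuous
    · refine Measure.ae_sum_iff.2 fun i => ?_
      filter_upwards [ae_le_essSup (f := g) (μ := μ i)] with t ht
      exact ht.trans (le_iSup (fun i => essSup g (μ i)) i)
  have hr : 0 < p.toReal := ENNReal.toReal_pos hp0 hp
  simp only [mixedNorm, eLpNorm_eq_lintegral_rpow hp0 hp, lintegral_count, one_div,
    ENNReal.rpow_inv_rpow hr.ne', lintegral_sum_measure]

lemma mixedNorm_comp_le [Countable κ] [MeasurableSingletonClass κ] {ν : κ → Measure β}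
    {φ : α → β} (hφ : Measurable φ) {σ : ι → κ} {c d : ℝ≥0∞} (hc : c ≠ 0) (hc' : c ≠ ⊤)
    (hd : d ≠ 0) (hμ : ∀ i, (μ i).map φ ≤ c • ν (σ i))
    (hσ : Measure.count.map σ ≤ d • Measure.count) {f : β → ℝ≥0∞} (hf : Measurable f)
    (p q : ℝ≥0∞) :
    mixedNorm μ p q (f ∘ φ) ≤
      c ^ (1 / p).toReal * d ^ (1 / q).toReal * mixedNorm ν p q f :=
  calc mixedNorm μ p q (f ∘ φ)
      ≤ eLpNorm (fun i => c ^ (1 / p).toReal * eLpNorm f p (ν (σ i))) q Measure.count :=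
        eLpNorm_mono_enorm fun i => eLpNorm_comp_le_of_map_le hφ hf hc (hμ i) p
    _ = c ^ (1 / p).toReal * eLpNorm ((fun k => eLpNorm f p (ν k)) ∘ σ) q Measure.count :=
        eLpNorm_const_mul_ennreal
          (ENNReal.rpow_ne_top_of_nonneg ENNReal.toReal_nonneg hc') _ q
    _ ≤ c ^ (1 / p).toReal * (d ^ (1 / q).toReal * mixedNorm ν p q f) := by
        gcongr
        exact eLpNorm_comp_le_of_map_le (measurable_of_countable σ) (measurable_of_countable _)
          hd hσ q
    _ = _ := (mul_assoc _ _ _).symm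

end mixedNorm

/-! ### Non-increasing rearrangement -/

section decreasingRearrangement

variable {α : Type*} [MeasurableSpace α]

/-- The non-increasing rearrangement on `[0, ∞)` of a `[0, ∞]`-valued function on an arbitrary
measure space, so that `rearrangement f` is `decreasingRearrangement lam (absFun f)`. -/
noncomputable def decreasingRearrangement (μ : Measure α) (g : α → ℝ≥0∞) (t : ℝ≥0) : ℝ≥0∞ :=
  ⨅ (s : ℝ≥0) (_ : μ {u | (s : ℝ≥0∞) < g u} ≤ t), (s : ℝ≥0∞)

variable {μ : Measure α} {g h : α → ℝ≥0∞} {s t : ℝ≥0}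

lemma decreasingRearrangement_le (hs : μ {u | (s : ℝ≥0∞) < g u} ≤ t) :
    decreasingRearrangement μ g t ≤ s :=
  iInf₂_le s hs

lemma antitone_decreasingRearrangement : Antitone (decreasingRearrangement μ g) := fun _ _ h =>
  le_iInf₂ fun _ hs => decreasingRearrangement_le (hs.trans (mod_cast h))

lemma measurable_decreasingRearrangement : Measurable (decreasingRearrangement μ g) :=
  antitone_decreasingRearrangement.measurable

lemma decreasingRearrangement_mono (hgh : ∀ᵐ u ∂μ, g u ≤ h u) (t : ℝ≥0) :
    decreasingRearrangement μ g t ≤ decreasingRearrangement μ h t :=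
  le_iInf₂ fun _ hs => decreasingRearrangement_le ((measure_mono_ae (by
    filter_upwards [hgh] with u hu h using lt_of_lt_of_le h hu)).trans hs)

lemma lt_decreasingRearrangement_iff :
    (s : ℝ≥0∞) < decreasingRearrangement μ g t ↔ (t : ℝ≥0∞) < μ {u | (s : ℝ≥0∞) < g u} := by
  refine ⟨fun h => not_le.1 fun h' => (decreasingRearrangement_le h').not_gt h, fun h => ?_⟩
  obtain ⟨r, r_anti, hsr, r_tendsto⟩ := exists_seq_strictAnti_tendsto s
  have superlevel_eq_iUnion : {u | (s : ℝ≥0∞) < g u} = ⋃ n, {u | (r n : ℝ≥0∞) < g u} := by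
    ext u
    simp only [Set.mem_iUnion, Set.mem_ofPred_eq]
    refine ⟨fun hu => ?_, fun ⟨n, hn⟩ => lt_trans (mod_cast hsr n) hn⟩
    exact ((ENNReal.tendsto_coe.2 r_tendsto).eventually_lt_const hu).exists
  have superlevel_mono : Monotone fun n => {u | (r n : ℝ≥0∞) < g u} := fun m n hmn u hu =>
    lt_of_le_of_lt (ENNReal.coe_le_coe.2 (r_anti.antitone hmn)) hu
  rw [superlevel_eq_iUnion, superlevel_mono.measure_iUnion, lt_iSup_iff] at h
  obtain ⟨n, hn⟩ := h
  refine lt_of_lt_of_le (ENNReal.coe_lt_coe.2 (hsr n)) (le_iInf₂ fun s' hs' => ?_)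
  by_contra! hlt
  exact hn.not_ge ((measure_mono fun u hu => lt_trans hlt hu).trans hs')

lemma lam_lt_decreasingRearrangement (μ : Measure α) (g : α → ℝ≥0∞) (s : ℝ≥0) :
    lam {t | (s : ℝ≥0∞) < decreasingRearrangement μ g t} = μ {u | (s : ℝ≥0∞) < g u} := by
  simp only [lt_decreasingRearrangement_iff, lam_setOf_coe_lt]

lemma decreasingRearrangement_const_mul (c : ℝ≥0) :
    decreasingRearrangement μ (fun u => c * g u) = fun t => c * decreasingRearrangement μ g t := by
  funext t
  rcases eq_or_ne c 0 with rfl | hc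
  · simpa using decreasingRearrangement_le (μ := μ) (g := fun _ => 0) (s := 0) (t := t) (by simp)
  have lt_mul_iff (s : ℝ≥0) (x : ℝ≥0∞) : (s : ℝ≥0∞) < c * x ↔ ((s / c : ℝ≥0) : ℝ≥0∞) < x := by
    rw [ENNReal.coe_div hc, mul_comm, ENNReal.div_lt_iff (by simp [hc]) (by simp)]
  have lt_iff (s : ℝ≥0) : (s : ℝ≥0∞) < decreasingRearrangement μ (fun u => c * g u) t ↔
      (s : ℝ≥0∞) < c * decreasingRearrangement μ g t := by
    simp only [lt_mul_iff, lt_decreasingRearrangement_iff]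
  exact le_antisymm (ENNReal.le_of_forall_nnreal_lt fun s hs => ((lt_iff s).1 hs).le)
    (ENNReal.le_of_forall_nnreal_lt fun s hs => ((lt_iff s).2 hs).le)

lemma decreasingRearrangement_add_le (g h : α → ℝ≥0∞) (t : ℝ≥0) :
    decreasingRearrangement μ (fun u => g u + h u) t ≤
      decreasingRearrangement μ g (t / 2) + decreasingRearrangement μ h (t / 2) := by
  simp only [decreasingRearrangement, ENNReal.iInf_add, ENNReal.add_iInf]
  refine le_iInf₂ fun s hs => le_iInf₂ fun r hr => ?_
  rw [← ENNReal.coe_add]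
  refine decreasingRearrangement_le ?_
  have superlevel_subset : {u | ((r + s : ℝ≥0) : ℝ≥0∞) < g u + h u} ⊆
      {u | (r : ℝ≥0∞) < g u} ∪ {u | (s : ℝ≥0∞) < h u} := by
    intro u hu
    by_contra! hn
    simp only [Set.mem_union, Set.mem_ofPred_eq, not_or, not_lt] at hn hu
    exact (add_le_add hn.1 hn.2).not_gt (by simpa using hu)
  calc μ {u | ((r + s : ℝ≥0) : ℝ≥0∞) < g u + h u}
      ≤ μ {u | (r : ℝ≥0∞) < g u} + μ {u | (s : ℝ≥0∞) < h u} :=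
        (measure_mono superlevel_subset).trans (measure_union_le _ _)
    _ ≤ (t / 2 : ℝ≥0) + (t / 2 : ℝ≥0) := add_le_add hr hs
    _ = t := by rw [← ENNReal.coe_add, add_halves]

lemma decreasingRearrangement_ae_eq_zero_iff :
    (∀ᵐ t ∂lam, decreasingRearrangement μ g t = 0) ↔ ∀ᵐ u ∂μ, g u = 0 := by
  simpa only [ae_iff, ← pos_iff_ne_zero, ENNReal.coe_zero] using
    iff_of_eq (congrArg (· = 0) (lam_lt_decreasingRearrangement μ g 0))

lemma iSup_decreasingRearrangement {F : ℕ → α → ℝ≥0∞}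
    (h : ∀ᵐ u ∂μ, Monotone (fun n => F n u) ∧ ⨆ n, F n u = g u) (t : ℝ≥0) :
    ⨆ n, decreasingRearrangement μ (F n) t = decreasingRearrangement μ g t := by
  refine le_antisymm (iSup_le fun n => decreasingRearrangement_mono ?_ t) ?_
  · filter_upwards [h] with u hu
    exact hu.2 ▸ le_iSup (fun n => F n u) n
  refine ENNReal.le_of_forall_nnreal_lt fun s hs => ?_
  rw [lt_decreasingRearrangement_iff] at hs
  have measure_superlevel_le :=
    calc μ {u | (s : ℝ≥0∞) < g u} ≤ μ (⋃ n, {u | (s : ℝ≥0∞) < F n u}) := by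
          refine measure_mono_ae ?_
          filter_upwards [h] with u hu hs
          exact Set.mem_iUnion.2 (lt_iSup_iff.1 (lt_of_lt_of_eq hs hu.2.symm))
      _ = ⨆ n, μ (Set.accumulate (fun n => {u | (s : ℝ≥0∞) < F n u}) n) :=
          measure_iUnion_eq_iSup_accumulate
      _ ≤ ⨆ n, μ {u | (s : ℝ≥0∞) < F n u} := by
          refine iSup_mono fun n => measure_mono_ae ?_
          filter_upwards [h] with u hu hs
          obtain ⟨m, hm, hs⟩ := Set.mem_accumulate.1 hs
          exact lt_of_lt_of_le hs (hu.1 hm)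
  obtain ⟨n, hn⟩ := lt_iSup_iff.1 (hs.trans_le measure_superlevel_le)
  exact (lt_decreasingRearrangement_iff.2 hn).le.trans
    (le_iSup (fun n => decreasingRearrangement μ (F n) t) n)

lemma eLpNorm_decreasingRearrangement [SFinite μ] (hg : AEMeasurable g μ) (p : ℝ≥0∞) :
    eLpNorm (decreasingRearrangement μ g) p lam = eLpNorm g p μ :=
  eLpNorm_eq_of_measure_lt_eq measurable_decreasingRearrangement.aemeasurable hg
    (lam_lt_decreasingRearrangement μ g) p

lemma decreasingRearrangement_eq_zero_of_measure_support_le (ht : μ g.support ≤ t) :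
    decreasingRearrangement μ g t = 0 := by
  have superlevel_eq : {u | ((0 : ℝ≥0) : ℝ≥0∞) < g u} = g.support := by
    ext u
    simp [pos_iff_ne_zero]
  exact nonpos_iff_eq_zero.1 (decreasingRearrangement_le (superlevel_eq ▸ ht))

lemma decreasingRearrangement_indicator_one_le {E : Set α} (hE : μ E ≤ t) :
    decreasingRearrangement μ (E.indicator fun _ => 1) ≤ (Set.Iio t).indicator fun _ => 1 := by
  intro u
  by_cases hu : u < t
  · rw [Set.indicator_of_mem (Set.mem_Iio.2 hu)]
    have le_one (v : α) : E.indicator (fun _ => 1) v ≤ (1 : ℝ≥0∞) :=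
      Set.indicator_apply_le' (fun _ => le_rfl) fun _ => zero_le_one
    exact decreasingRearrangement_le (s := 1) (by simp [(le_one _).not_gt])
  · rw [Set.indicator_of_notMem (by simpa using hu),
      decreasingRearrangement_eq_zero_of_measure_support_le]
    exact (measure_mono Set.support_indicator_subset).trans (hE.trans (mod_cast not_lt.1 hu))

end decreasingRearrangement

lemma rearrangement_eq_decreasingRearrangement (f : ℝ≥0 → ExtComplex) :
    rearrangement f = decreasingRearrangement lam (absFun f) :=
  rfl

/-! ### Unit cells and the Wiener amalgam functional -/

/-- Lebesgue measure on the unit cell `[n, n + 1)`. -/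
noncomputable def cell (n : ℕ) : Measure ℝ≥0 := lam.restrict (Set.Ico (n : ℝ≥0) (n + 1))

instance (n : ℕ) : IsProbabilityMeasure (cell n) :=
  ⟨by rw [cell, Measure.restrict_apply_univ, lam_Ico, add_tsub_cancel_left, ENNReal.coe_one]⟩

lemma ae_cell {n : ℕ} {P : ℝ≥0 → Prop} (h : ∀ t : ℝ≥0, (n : ℝ≥0) ≤ t → t < n + 1 → P t) :
    ∀ᵐ t ∂cell n, P t :=
  (ae_restrict_iff' measurableSet_Ico).2 (ae_of_all _ fun t ht => h t ht.1 ht.2)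

lemma sum_cell_add (k : ℕ) :
    Measure.sum (fun n => cell (n + k)) = lam.restrict (Set.Ici (k : ℝ≥0)) := by
  set a : ℕ → ℝ≥0 := fun n => ((n + k : ℕ) : ℝ≥0) with ha
  have monotone_a : Monotone a := fun m n hmn => Nat.cast_le.2 (Nat.add_le_add_right hmn k)
  have unbounded_a : ¬BddAbove (Set.range a) := not_bddAbove_of_tendsto_atTop
    (tendsto_natCast_atTop_atTop.comp (tendsto_add_atTop_nat k))
  have iUnion_Ico : ⋃ n, Set.Ico (a n) (a (Order.succ n)) = Set.Ici (k : ℝ≥0) :=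
    (iUnion_Ico_map_succ_eq_Ici (fun n => monotone_a bot_le) unbounded_a).trans (by simp [ha])
  rw [← iUnion_Ico, Measure.restrict_iUnion monotone_a.pairwise_disjoint_on_Ico_succ
    fun _ => measurableSet_Ico]
  simp only [cell, ha, Order.succ_eq_add_one, Nat.cast_add, Nat.cast_one, add_right_comm]

lemma sum_cell : Measure.sum cell = lam := by
  simpa using sum_cell_add 0

lemma eLpNorm_indicator_Icc_eq_eLpNorm_cell (p : ℝ≥0∞) (h : ℝ≥0 → ℝ≥0∞) :
    eLpNorm ((Set.Icc 0 1).indicator h) p lam = eLpNorm h p (cell 0) := by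
  rw [eLpNorm_indicator_eq_eLpNorm_restrict measurableSet_Icc, cell, Nat.cast_zero, zero_add,
    Measure.restrict_congr_set Ico_ae_eq_Icc]

lemma eLpNorm_indicator_Ioi_eq_mixedNorm (q : ℝ≥0∞) (h : ℝ≥0 → ℝ≥0∞) :
    eLpNorm ((Set.Ioi 1).indicator h) q lam = mixedNorm (fun n => cell (n + 1)) q q h := by
  rw [eLpNorm_indicator_eq_eLpNorm_restrict measurableSet_Ioi, mixedNorm_self, sum_cell_add,
    Nat.cast_one, Measure.restrict_congr_set Ioi_ae_eq_Ici]

lemma wienerNorm_eq_mixedNorm {q : ℝ≥0∞} (hq : q ≠ 0) (p : ℝ≥0∞) (f : ℝ≥0 → ExtComplex) :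
    wienerNorm p q f = mixedNorm cell p q (absFun f) := by
  simp only [wienerNorm, mixedNorm, lebesgueNorm, absFun_lift,
    eLpNorm_indicator_eq_eLpNorm_restrict measurableSet_Ico, cell]
  split_ifs with h
  · simp only [h, eLpNorm_top_eq_essSup, essSup_count]
  · simp only [eLpNorm_eq_lintegral_rpow hq h, lintegral_count]

lemma wienerNorm_lift {q : ℝ≥0∞} (hq : q ≠ 0) (p : ℝ≥0∞) (g : ℝ≥0 → ℝ≥0∞) :
    wienerNorm p q (lift g) = mixedNorm cell p q g := by
  rw [wienerNorm_eq_mixedNorm hq, absFun_lift]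

/-! ### Dilation by two -/

lemma map_half_cell_le (n : ℕ) :
    (cell n).map (fun t : ℝ≥0 => t / 2) ≤ (2 : ℝ≥0∞) • cell (n / 2) := by
  set I := Set.Ico ((n / 2 : ℕ) : ℝ≥0) ((n / 2 : ℕ) + 1)
  have Ico_subset : Set.Ico (n : ℝ≥0) (n + 1) ⊆ (fun t : ℝ≥0 => t / 2) ⁻¹' I := by
    rintro t ⟨hnt, htn⟩
    have two_mul_half_le : 2 * (n / 2) ≤ n := by lia
    have succ_le_two_mul : n + 1 ≤ 2 * (n / 2 + 1) := by lia
    constructor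
    · rw [le_div_iff₀ two_pos, mul_comm]
      exact le_trans (mod_cast two_mul_half_le) hnt
    · rw [div_lt_iff₀ two_pos, mul_comm]
      exact htn.trans_le (mod_cast succ_le_two_mul)
  calc (cell n).map (fun t : ℝ≥0 => t / 2)
      ≤ (lam.restrict ((fun t : ℝ≥0 => t / 2) ⁻¹' I)).map (fun t : ℝ≥0 => t / 2) :=
        Measure.map_mono (Measure.restrict_mono Ico_subset le_rfl) (by fun_prop)
    _ = (2 : ℝ≥0∞) • cell (n / 2) := by
        rw [← Measure.restrict_map (by fun_prop) measurableSet_Ico, map_half_lam,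
          Measure.restrict_smul, cell]

lemma map_half_count_le :
    (Measure.count : Measure ℕ).map (fun n => n / 2) ≤ (2 : ℝ≥0∞) • Measure.count := by
  refine Measure.le_iff.2 fun s hs => ?_
  have preimage_subset :
      (fun n => n / 2) ⁻¹' s ⊆ (fun n => 2 * n) '' s ∪ (fun n => 2 * n + 1) '' s := by
    intro n hn
    rcases Nat.even_or_odd' n with ⟨k, rfl | rfl⟩
    · exact Or.inl ⟨k, by simpa using hn, rfl⟩
    · exact Or.inr ⟨k, by simpa [Nat.mul_add_div] using hn, rfl⟩
  calc (Measure.count : Measure ℕ).map (fun n => n / 2) s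
      ≤ Measure.count ((fun n => 2 * n) '' s ∪ (fun n => 2 * n + 1) '' s) := by
        rw [Measure.map_apply (measurable_of_countable _) hs]
        exact measure_mono preimage_subset
    _ ≤ Measure.count ((fun n => 2 * n) '' s) + Measure.count ((fun n => 2 * n + 1) '' s) :=
        measure_union_le _ _
    _ = Measure.count s + Measure.count s := by
        rw [Measure.count_injective_image (fun a b h => by simpa using h),
          Measure.count_injective_image (fun a b h => by simpa using h)]
    _ = ((2 : ℝ≥0∞) • Measure.count) s := by
        rw [Measure.smul_apply, smul_eq_mul, two_mul]

lemma mixedNorm_cell_comp_half_le {h : ℝ≥0 → ℝ≥0∞} (hh : Measurable h) (p q : ℝ≥0∞) :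
    mixedNorm cell p q (fun t => h (t / 2)) ≤
      2 ^ (1 / p).toReal * 2 ^ (1 / q).toReal * mixedNorm cell p q h :=
  mixedNorm_comp_le (by fun_prop) two_ne_zero ENNReal.ofNat_ne_top two_ne_zero map_half_cell_le
    map_half_count_le hh p q

/-! ### Amalgam norms of non-increasing functions -/

lemma eLpNorm_cell_le_of_antitone {h : ℝ≥0 → ℝ≥0∞} (hh : Antitone h) {p : ℝ≥0∞} (hp : p ≠ 0)
    (n : ℕ) : eLpNorm h p (cell n) ≤ h n :=
  calc eLpNorm h p (cell n) ≤ eLpNorm (fun _ => h n) p (cell n) :=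
        eLpNorm_mono_enorm_ae (ae_cell fun _ ht _ => hh ht)
    _ = h n := eLpNorm_const_of_isProbabilityMeasure hp _

lemma le_eLpNorm_cell_of_antitone {h : ℝ≥0 → ℝ≥0∞} (hh : Antitone h) {p : ℝ≥0∞} (hp : p ≠ 0)
    (n : ℕ) : h (n + 1) ≤ eLpNorm h p (cell n) :=
  calc h (n + 1) = eLpNorm (fun _ => h (n + 1)) p (cell n) :=
        (eLpNorm_const_of_isProbabilityMeasure hp _).symm
    _ ≤ eLpNorm h p (cell n) := eLpNorm_mono_enorm_ae (ae_cell fun _ _ ht => hh ht.le)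

lemma eLpNorm_cell_succ_le_of_antitone {h : ℝ≥0 → ℝ≥0∞} (hh : Antitone h) {p q : ℝ≥0∞}
    (hp : p ≠ 0) (hq : q ≠ 0) (n : ℕ) : eLpNorm h p (cell (n + 1)) ≤ eLpNorm h q (cell n) :=
  (eLpNorm_cell_le_of_antitone hh hp (n + 1)).trans
    (by simpa using le_eLpNorm_cell_of_antitone hh hq n)

lemma map_count_of_injective {ι κ : Type*} [MeasurableSpace ι] [MeasurableSpace κ]
    [MeasurableSingletonClass ι] [MeasurableSingletonClass κ] {σ : ι → κ} (hσ : σ.Injective)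
    (hσm : Measurable σ) : Measure.count.map σ = Measure.count.restrict (Set.range σ) := by
  ext s hs
  rw [Measure.map_apply hσm hs, Measure.restrict_apply hs, ← Measure.count_injective_image hσ,
    Set.image_preimage_eq_inter_range]

lemma eLpNorm_count_le_add_succ {q : ℝ≥0∞} (hq : q ≠ 0) (b : ℕ → ℝ≥0∞) :
    eLpNorm b q Measure.count ≤
      q.LpAddConst * (b 0 + eLpNorm (fun n => b (n + 1)) q Measure.count) := by
  have indicator_add : ({0} : Set ℕ).indicator (fun _ => b 0) +
      (Set.range Nat.succ).indicator b = b := by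
    funext n
    cases n <;> simp
  have eLpNorm_head :
      eLpNorm (({0} : Set ℕ).indicator (fun _ => b 0)) q Measure.count = b 0 := by
    rw [eLpNorm_indicator_const' (measurableSet_singleton 0) (by simp) hq]
    simp
  have eLpNorm_tail : eLpNorm ((Set.range Nat.succ).indicator b) q Measure.count =
      eLpNorm (fun n => b (n + 1)) q Measure.count := by
    rw [eLpNorm_indicator_eq_eLpNorm_restrict (Set.to_countable _).measurableSet,
      ← map_count_of_injective Nat.succ_injective (measurable_of_countable _)]
    exact eLpNorm_map_measure (measurable_of_countable _).aestronglyMeasurable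
      (measurable_of_countable _).aemeasurable
  rw [← eLpNorm_tail, ← eLpNorm_head]
  conv_lhs => rw [← indicator_add]
  exact eLpNorm_add_le' (measurable_of_countable _).aestronglyMeasurable
    (measurable_of_countable _).aestronglyMeasurable q

lemma mixedNorm_cell_le_of_antitone {h : ℝ≥0 → ℝ≥0∞} (hh : Antitone h) {p q : ℝ≥0∞} (hp : p ≠ 0)
    (hq : q ≠ 0) :
    mixedNorm cell p q h ≤ (q.LpAddConst + q.LpAddConst ^ 2) *
      (eLpNorm ((Set.Icc 0 1).indicator h) p lam + eLpNorm ((Set.Ioi 1).indicator h) q lam) := by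
  rw [eLpNorm_indicator_Icc_eq_eLpNorm_cell, eLpNorm_indicator_Ioi_eq_mixedNorm]
  set A := q.LpAddConst
  set B := eLpNorm h p (cell 0)
  set T := mixedNorm (fun n => cell (n + 1)) q q h
  calc mixedNorm cell p q h
      ≤ A * (B + eLpNorm (fun n : ℕ => eLpNorm h p (cell (n + 1))) q Measure.count) :=
        eLpNorm_count_le_add_succ hq _
    _ ≤ A * (B + A * (eLpNorm h p (cell (0 + 1)) +
          eLpNorm (fun n : ℕ => eLpNorm h p (cell (n + 1 + 1))) q Measure.count)) := by
        gcongr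
        exact eLpNorm_count_le_add_succ hq fun n => eLpNorm h p (cell (n + 1))
    _ ≤ A * (B + A * (B + T)) := by
        gcongr
        · exact eLpNorm_cell_succ_le_of_antitone hh hp hp 0
        · exact eLpNorm_mono_enorm fun n => eLpNorm_cell_succ_le_of_antitone hh hp hq (n + 1)
    _ ≤ A * ((B + T) + A * (B + T)) := by
        gcongr
        exact le_self_add
    _ = (A + A ^ 2) * (B + T) := by ring

lemma le_mixedNorm_cell_of_antitone {h : ℝ≥0 → ℝ≥0∞} (hh : Antitone h) {p q : ℝ≥0∞} (hp : p ≠ 0)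
    (hq : q ≠ 0) :
    eLpNorm ((Set.Icc 0 1).indicator h) p lam + eLpNorm ((Set.Ioi 1).indicator h) q lam ≤
      2 * mixedNorm cell p q h := by
  rw [eLpNorm_indicator_Icc_eq_eLpNorm_cell, eLpNorm_indicator_Ioi_eq_mixedNorm, two_mul]
  exact add_le_add (eLpNorm_le_mixedNorm hq 0)
    (eLpNorm_mono_enorm fun n => eLpNorm_cell_succ_le_of_antitone hh hq hp n)

/-! ### Functions of finite-measure support -/

lemma mixedNorm_cell_lt_top_iff_of_bounded_support {h : ℝ≥0 → ℝ≥0∞} {p q : ℝ≥0∞} (hp : p ≠ 0)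
    (hq : q ≠ 0) {N : ℕ} (hN : ∀ t : ℝ≥0, N ≤ t → h t = 0) :
    mixedNorm cell p q h < ⊤ ↔ eLpNorm h p lam < ⊤ := by
  have finite_support : (fun n => eLpNorm h p (cell n)).support.Finite := by
    refine (Set.finite_Iio N).subset (Function.support_subset_iff'.2 fun n hn => ?_)
    have hNn : (N : ℝ≥0) ≤ n := mod_cast not_lt.1 hn
    exact (eLpNorm_congr_ae (g := 0) (ae_cell fun t ht _ => hN t (hNn.trans ht))).trans
      eLpNorm_zero
  rw [← sum_cell, ← mixedNorm_self cell p h]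
  exact (eLpNorm_count_lt_top_iff_of_finite_support finite_support hq).trans
    (eLpNorm_count_lt_top_iff_of_finite_support finite_support hp).symm

lemma mixedNorm_cell_decreasingRearrangement_lt_top_iff {α : Type*} [MeasurableSpace α]
    {μ : Measure α} [SFinite μ] {g : α → ℝ≥0∞} (hg : AEMeasurable g μ) (hsupp : μ g.support < ⊤)
    {p q : ℝ≥0∞} (hp : p ≠ 0) (hq : q ≠ 0) :
    mixedNorm cell p q (decreasingRearrangement μ g) < ⊤ ↔ eLpNorm g p μ < ⊤ := by
  obtain ⟨N, hN⟩ := ENNReal.exists_nat_gt hsupp.ne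
  rw [← eLpNorm_decreasingRearrangement hg p]
  refine mixedNorm_cell_lt_top_iff_of_bounded_support hp hq (N := N) fun t ht => ?_
  exact decreasingRearrangement_eq_zero_of_measure_support_le (hN.le.trans (mod_cast ht))

/-! ### Functions separating the exponents -/

/-- The union of the intervals `[n, n + e n)`, for `e n ≤ 1`. -/
def blocks (e : ℕ → ℝ≥0) : Set ℝ≥0 := {t | t < ⌊t⌋₊ + e ⌊t⌋₊}

lemma measurableSet_blocks (e : ℕ → ℝ≥0) : MeasurableSet (blocks e) :=
  measurableSet_lt measurable_id
    ((measurable_of_countable fun n : ℕ => (n : ℝ≥0) + e n).comp Nat.measurable_floor)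

/-- The step function with the value `c n` on `[n, n + e n)`, which separates amalgam norms with
different exponents for suitable `e` and `c`. -/
noncomputable def blockFun (e c : ℕ → ℝ≥0) : ℝ≥0 → ℝ≥0∞ :=
  (blocks e).indicator fun t => c ⌊t⌋₊

lemma measurable_blockFun (e c : ℕ → ℝ≥0) : Measurable (blockFun e c) :=
  ((measurable_of_countable fun n : ℕ => (c n : ℝ≥0∞)).comp Nat.measurable_floor).indicator
    (measurableSet_blocks e)

lemma eLpNorm_blockFun {e : ℕ → ℝ≥0} (he0 : ∀ n, e n ≠ 0) (he1 : ∀ n, e n ≤ 1) (c : ℕ → ℝ≥0)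
    {p : ℝ≥0∞} (hp : p ≠ 0) (n : ℕ) :
    eLpNorm (blockFun e c) p (cell n) = c n * (e n : ℝ≥0∞) ^ (1 / p.toReal) := by
  have blockFun_ae_eq : blockFun e c =ᵐ[cell n]
      (Set.Ico (n : ℝ≥0) (n + e n)).indicator fun _ => (c n : ℝ≥0∞) := by
    refine ae_cell fun t hnt htn => ?_
    have floor_eq : ⌊t⌋₊ = n := (Nat.floor_eq_iff zero_le).2 ⟨hnt, htn⟩
    simp [blockFun, blocks, Set.indicator_apply, floor_eq, hnt]
  have cell_Ico : cell n (Set.Ico (n : ℝ≥0) (n + e n)) = e n := by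
    rw [cell, Measure.restrict_apply measurableSet_Ico, Set.inter_eq_left.2, lam_Ico,
      add_tsub_cancel_left]
    exact Set.Ico_subset_Ico_right (by gcongr; exact he1 n)
  rw [eLpNorm_congr_ae blockFun_ae_eq, eLpNorm_indicator_const' measurableSet_Ico
    (by simpa [cell_Ico] using he0 n) hp, cell_Ico, enorm_eq_self]

/-- The power sequence `(n + 1) ^ s`, shifted so that it starts at `1` instead of at a power of
`0`. -/
noncomputable def powSeq (s : ℝ) (n : ℕ) : ℝ≥0 := ((n : ℝ≥0) + 1) ^ s

lemma powSeq_ne_zero (s : ℝ) (n : ℕ) : powSeq s n ≠ 0 :=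
  (NNReal.rpow_pos (by positivity)).ne'

lemma powSeq_le_one {s : ℝ} (hs : s ≤ 0) (n : ℕ) : powSeq s n ≤ 1 :=
  NNReal.rpow_le_one_of_one_le_of_nonpos (by simp) hs

lemma powSeq_mul_rpow (s r x : ℝ) (n : ℕ) :
    (powSeq s n : ℝ≥0∞) * (powSeq r n : ℝ≥0∞) ^ x = powSeq (s + r * x) n := by
  rw [← ENNReal.coe_rpow_of_ne_zero (powSeq_ne_zero r n), ← ENNReal.coe_mul]
  unfold powSeq
  rw [← NNReal.rpow_mul, ← NNReal.rpow_add (by positivity)]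

lemma tsum_powSeq_ne_top_iff {s : ℝ} : ∑' n, (powSeq s n : ℝ≥0∞) ≠ ⊤ ↔ s < -1 := by
  rw [ENNReal.tsum_coe_ne_top_iff_summable, ← NNReal.summable_rpow,
    ← NNReal.summable_nat_add_iff (f := fun n : ℕ => (n : ℝ≥0) ^ s) 1]
  simp only [Nat.cast_add, Nat.cast_one]
  rfl

lemma eLpNorm_powSeq_lt_top_iff {s : ℝ} {q : ℝ≥0∞} (hq0 : q ≠ 0) (hq : q ≠ ⊤) :
    eLpNorm (fun n => (powSeq s n : ℝ≥0∞)) q Measure.count < ⊤ ↔ s < -(1 / q.toReal) := by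
  have hr : 0 < q.toReal := ENNReal.toReal_pos hq0 hq
  have rpow_powSeq (n : ℕ) :
      (powSeq s n : ℝ≥0∞) ^ q.toReal = (powSeq (s * q.toReal) n : ℝ≥0∞) := by
    simpa [powSeq] using powSeq_mul_rpow 0 s q.toReal n
  rw [eLpNorm_eq_lintegral_rpow hq0 hq, lintegral_count,
    ENNReal.rpow_lt_top_iff_of_pos (one_div_pos.2 hr), lt_top_iff_ne_top]
  simp only [rpow_powSeq]
  rw [tsum_powSeq_ne_top_iff, ← neg_div, lt_div_iff₀ hr]

lemma eLpNorm_powSeq_lt_top {s : ℝ} {q : ℝ≥0∞} (hq0 : q ≠ 0) (hs : s < -(1 / q.toReal)) :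
    eLpNorm (fun n => (powSeq s n : ℝ≥0∞)) q Measure.count < ⊤ := by
  rcases eq_or_ne q ⊤ with rfl | hq
  · rw [eLpNorm_top_eq_essSup, essSup_count]
    refine (iSup_le fun n => ?_).trans_lt ENNReal.one_lt_top
    exact_mod_cast powSeq_le_one (by simpa using hs.le) n
  · exact (eLpNorm_powSeq_lt_top_iff hq0 hq).2 hs

lemma eLpNorm_powSeq_eq_top {s : ℝ} {q : ℝ≥0∞} (hq0 : q ≠ 0) (hq : q ≠ ⊤)
    (hs : -(1 / q.toReal) ≤ s) :
    eLpNorm (fun n => (powSeq s n : ℝ≥0∞)) q Measure.count = ⊤ :=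
  not_lt_top_iff.1 fun h => hs.not_gt ((eLpNorm_powSeq_lt_top_iff hq0 hq).1 h)

lemma mixedNorm_blockFun_powSeq {p : ℝ≥0∞} (hp : p ≠ 0) {r : ℝ} (hr : 0 ≤ r) (q : ℝ≥0∞) (s : ℝ) :
    mixedNorm cell p q (blockFun (powSeq (-r)) (powSeq s)) =
      eLpNorm (fun n => (powSeq (s + -r * (1 / p.toReal)) n : ℝ≥0∞)) q Measure.count := by
  simp only [mixedNorm, eLpNorm_blockFun (powSeq_ne_zero (-r))
    (powSeq_le_one (neg_nonpos.2 hr)) _ hp, powSeq_mul_rpow]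

lemma blockFun_powSeq_zero (e : ℕ → ℝ≥0) :
    blockFun e (powSeq 0) = (blocks e).indicator fun _ => 1 := by
  simp [blockFun, powSeq]

lemma lam_blocks_powSeq_lt_top {r : ℝ} (hr : 1 < r) : lam (blocks (powSeq (-r))) < ⊤ := by
  have lam_eq_mixedNorm : lam (blocks (powSeq (-r))) =
      mixedNorm cell 1 1 (blockFun (powSeq (-r)) (powSeq 0)) := by
    rw [mixedNorm_self, sum_cell, blockFun_powSeq_zero, eLpNorm_one_eq_lintegral_enorm]
    simp only [enorm_eq_self]
    exact (lintegral_indicator_one (measurableSet_blocks _)).symm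
  rw [lam_eq_mixedNorm, mixedNorm_blockFun_powSeq one_ne_zero (zero_le_one.trans hr.le)]
  exact eLpNorm_powSeq_lt_top one_ne_zero (by simpa using hr)

lemma one_div_toReal_lt_one_div_toReal {p q : ℝ≥0∞} (hq : q ≠ 0) (h : q < p) :
    1 / p.toReal < 1 / q.toReal := by
  rw [one_div, one_div, ← ENNReal.toReal_inv, ← ENNReal.toReal_inv]
  exact ENNReal.toReal_strict_mono (ENNReal.inv_ne_top.2 hq) (ENNReal.inv_lt_inv.2 h)

lemma exists_one_lt_mul_lt {x y : ℝ} (hxy : x < y) : ∃ r : ℝ, 1 < r ∧ r * x < y := by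
  have mul_lt_near_one : ∀ᶠ r in 𝓝[>] (1 : ℝ), r * x < y :=
    (((continuous_mul_const x).tendsto' 1 x (one_mul x)).eventually_lt_const hxy).filter_mono
      nhdsWithin_le_nhds
  exact (eventually_mem_nhdsWithin.and mul_lt_near_one).exists

lemma exists_mixedNorm_indicator_one_eq_top {p q : ℝ≥0∞} (hq : q ≠ 0) (h : q < p) :
    ∃ E : Set ℝ≥0, MeasurableSet E ∧ lam E < ⊤ ∧
      mixedNorm cell p q (E.indicator fun _ => 1) = ⊤ := by
  obtain ⟨r, hr, hrx⟩ := exists_one_lt_mul_lt (one_div_toReal_lt_one_div_toReal hq h)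
  refine ⟨blocks (powSeq (-r)), measurableSet_blocks _, lam_blocks_powSeq_lt_top hr, ?_⟩
  rw [← blockFun_powSeq_zero, mixedNorm_blockFun_powSeq (bot_lt_of_lt h).ne'
    (zero_le_one.trans hr.le)]
  exact eLpNorm_powSeq_eq_top hq h.ne_top (by linarith)

lemma exists_mixedNorm_lt_top_eLpNorm_eq_top {p q : ℝ≥0∞} (hp : p ≠ 0) (h : p < q) {a : ℝ≥0∞}
    (ha0 : a ≠ 0) (ha : a ≠ ⊤) :
    ∃ g : ℝ≥0 → ℝ≥0∞, Measurable g ∧ lam g.support < ⊤ ∧ mixedNorm cell p q g < ⊤ ∧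
      eLpNorm g a lam = ⊤ := by
  obtain ⟨r, hr, hrx⟩ := exists_one_lt_mul_lt
    (sub_lt_sub_left (one_div_toReal_lt_one_div_toReal hp h) (1 / a.toReal))
  have hr0 : 0 ≤ r := zero_le_one.trans hr.le
  refine ⟨blockFun (powSeq (-r)) (powSeq ((r - 1) * (1 / a.toReal))), measurable_blockFun _ _,
    (measure_mono Set.support_indicator_subset).trans_lt (lam_blocks_powSeq_lt_top hr), ?_, ?_⟩
  · rw [mixedNorm_blockFun_powSeq hp hr0]
    exact eLpNorm_powSeq_lt_top (bot_lt_of_lt h).ne' (by linarith)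
  · rw [← sum_cell, ← mixedNorm_self cell, mixedNorm_blockFun_powSeq ha0 hr0]
    exact eLpNorm_powSeq_eq_top ha0 ha (by linarith)

/-! ### Rearranging a quasinorm -/

/-- Boundedness of the dilation `g ↦ g(· / 2)` with respect to a functional. Together with
`(g + h)*(t) ≤ g*(t / 2) + h*(t / 2)` it makes `f ↦ N (f*)` quasi-subadditive. -/
def DilationBounded (N : Functional) : Prop :=
  ∃ K : ℝ≥0, ∀ g : ℝ≥0 → ℝ≥0∞, Measurable g → N (lift fun t => g (t / 2)) ≤ K * N (lift g)

section rearranged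

variable {N : Functional}

lemma rearranged_eq (N : Functional) (f : ℝ≥0 → ExtComplex) :
    rearranged N f = N (lift (decreasingRearrangement lam (absFun f))) := by
  rw [rearranged, rearrangement_eq_decreasingRearrangement]

lemma rearranged_lift (N : Functional) (g : ℝ≥0 → ℝ≥0∞) :
    rearranged N (lift g) = N (lift (decreasingRearrangement lam g)) := by
  rw [rearranged_eq, absFun_lift]

lemma absInvariant_rearranged (N : Functional) : AbsInvariant (rearranged N) := fun f _ => by
  rw [rearranged_lift, rearranged_eq]

lemma rearrangementInvariant_rearranged (N : Functional) :
    RearrangementInvariant (rearranged N) := fun f g _ _ h => by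
  have rearrangement_eq : rearrangement f = rearrangement g := by
    funext t
    simp only [rearrangement, h _]
  rw [rearranged, rearranged, rearrangement_eq]

lemma Homogeneous.apply_lift_const_mul (hN : Homogeneous N) (c : ℝ≥0) {g : ℝ≥0 → ℝ≥0∞}
    (hg : AEMeasurable g lam) : N (lift fun t => c * g t) = c * N (lift g) := by
  have lift_const_mul : (lift fun t => c * g t) = fun t => scale ((c : ℝ) : ℂ) (ofNonneg (g t)) :=
    funext fun t => ofNonneg_coe_mul c (g t)
  rw [lift_const_mul, hN _ g hg]
  simp [enorm_eq_nnnorm]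

lemma Homogeneous.rearranged (hN : Homogeneous N) : Homogeneous (rearranged N) := fun a f _ => by
  rw [rearranged_eq, absFun_scale, rearranged_lift, enorm_eq_nnnorm,
    decreasingRearrangement_const_mul,
    hN.apply_lift_const_mul _ measurable_decreasingRearrangement.aemeasurable]

lemma Definite.rearranged (hN : Definite N) : Definite (rearranged N) := fun f _ => by
  rw [rearranged_lift, hN _ measurable_decreasingRearrangement.aemeasurable,
    decreasingRearrangement_ae_eq_zero_iff]

lemma AxiomP2.rearranged (hN : AxiomP2 N) : AxiomP2 (rearranged N) := fun f g _ _ h => by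
  simp only [rearranged_lift]
  exact hN _ _ measurable_decreasingRearrangement.aemeasurable
    measurable_decreasingRearrangement.aemeasurable
    (ae_of_all _ (decreasingRearrangement_mono h))

lemma monotone_and_tendsto_iff {x : ℕ → ℝ≥0∞} {y : ℝ≥0∞} :
    Monotone x ∧ Tendsto x atTop (𝓝 y) ↔ Monotone x ∧ ⨆ n, x n = y :=
  and_congr_right fun hx =>
    ⟨fun h => iSup_eq_of_tendsto hx h, fun h => h ▸ tendsto_atTop_iSup hx⟩

lemma AxiomP3.rearranged (hN : AxiomP3 N) : AxiomP3 (rearranged N) := fun F f _ _ h => by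
  simp only [rearranged_lift]
  refine hN _ _ (fun n => measurable_decreasingRearrangement.aemeasurable)
    measurable_decreasingRearrangement.aemeasurable (ae_of_all _ fun t => ?_)
  exact monotone_and_tendsto_iff.2
    ⟨fun m n hmn => decreasingRearrangement_mono (h.mono fun t ht => ht.1 hmn) t,
      iSup_decreasingRearrangement (h.mono fun t ht => monotone_and_tendsto_iff.1 ht) t⟩

lemma AxiomQ1.rearranged (h1 : AxiomQ1 N) (h2 : AxiomP2 N) (hD : DilationBounded N) :
    AxiomQ1 (rearranged N) := by
  obtain ⟨C, hC, hadd⟩ := h1.quasi_subadditive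
  obtain ⟨K, hK⟩ := hD
  refine ⟨h1.homogeneous.rearranged, h1.definite.rearranged, C * max K 1,
    one_le_mul hC (le_max_right K 1), fun f g _ _ => ?_⟩
  have measurable_half (f : ℝ≥0 → ℝ≥0∞) :
      Measurable fun t => decreasingRearrangement lam f (t / 2) :=
    measurable_decreasingRearrangement.comp (by fun_prop)
  have half_le (f : ℝ≥0 → ℝ≥0∞) : N (lift fun t => decreasingRearrangement lam f (t / 2)) ≤
      (max K 1 : ℝ≥0) * N (lift (decreasingRearrangement lam f)) :=
    (hK _ measurable_decreasingRearrangement).trans (by gcongr; exact le_max_left K 1)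
  simp only [rearranged_lift]
  calc N (lift (decreasingRearrangement lam fun t => f t + g t))
      ≤ N (lift fun t => decreasingRearrangement lam f (t / 2) +
          decreasingRearrangement lam g (t / 2)) :=
        h2 _ _ measurable_decreasingRearrangement.aemeasurable
          ((measurable_half f).add (measurable_half g)).aemeasurable
          (ae_of_all _ (decreasingRearrangement_add_le f g))
    _ ≤ C * (N (lift fun t => decreasingRearrangement lam f (t / 2)) +
          N (lift fun t => decreasingRearrangement lam g (t / 2))) :=
        hadd _ _ (measurable_half f).aemeasurable (measurable_half g).aemeasurable
    _ ≤ C * ((max K 1 : ℝ≥0) * N (lift (decreasingRearrangement lam f)) +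
          (max K 1 : ℝ≥0) * N (lift (decreasingRearrangement lam g))) := by
        gcongr
        · exact half_le f
        · exact half_le g
    _ = (C * max K 1 : ℝ≥0) * (N (lift (decreasingRearrangement lam f)) +
          N (lift (decreasingRearrangement lam g))) := by
        rw [ENNReal.coe_mul, ← mul_add, mul_assoc]

lemma axiomP4_rearranged (h2 : AxiomP2 N)
    (hN : ∀ a : ℝ≥0, N (lift ((Set.Iio a).indicator fun _ => 1)) < ⊤) :
    AxiomP4 (rearranged N) := fun E _ hE => by
  rw [rearranged_lift]
  exact (h2 _ _ measurable_decreasingRearrangement.aemeasurable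
    (aemeasurable_const.indicator measurableSet_Iio) (ae_of_all _
      (decreasingRearrangement_indicator_one_le (ENNReal.coe_toNNReal hE.ne).ge))).trans_lt (hN _)

theorem isQuasiBanachFunctionNorm_rearranged (h1 : AxiomQ1 N) (h2 : AxiomP2 N) (h3 : AxiomP3 N)
    (hIio : ∀ a : ℝ≥0, N (lift ((Set.Iio a).indicator fun _ => 1)) < ⊤)
    (hD : DilationBounded N) : IsQuasiBanachFunctionNorm (rearranged N) :=
  ⟨absInvariant_rearranged N, h1.rearranged h2 hD, h2.rearranged, h3.rearranged,
    axiomP4_rearranged h2 hIio⟩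

end rearranged

/-! ### Axioms of the Wiener amalgam functional -/

section wienerNorm

variable {p q : ℝ≥0∞}

lemma absInvariant_wienerNorm (hq : q ≠ 0) : AbsInvariant (wienerNorm p q) := fun f _ => by
  rw [wienerNorm_lift hq, wienerNorm_eq_mixedNorm hq]

lemma homogeneous_wienerNorm (hq : q ≠ 0) : Homogeneous (wienerNorm p q) := fun a f _ => by
  rw [wienerNorm_eq_mixedNorm hq, wienerNorm_lift hq, absFun_scale,
    mixedNorm_const_mul enorm_ne_top]

lemma definite_wienerNorm (hp : p ≠ 0) (hq : q ≠ 0) : Definite (wienerNorm p q) := fun f hf => by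
  rw [wienerNorm_lift hq, mixedNorm_eq_zero_iff hp hq (by rwa [sum_cell]), sum_cell]

lemma wienerNorm_lift_add_le (hq : q ≠ 0) {f g : ℝ≥0 → ℝ≥0∞} (hf : AEMeasurable f lam)
    (hg : AEMeasurable g lam) :
    wienerNorm p q (lift fun t => f t + g t) ≤ p.LpAddConst * q.LpAddConst *
      (wienerNorm p q (lift f) + wienerNorm p q (lift g)) := by
  simp only [wienerNorm_lift hq]
  exact mixedNorm_add_le (by rwa [sum_cell]) (by rwa [sum_cell])

lemma exists_one_le_coe_ge {c : ℝ≥0∞} (hc : c ≠ ⊤) : ∃ C : ℝ≥0, 1 ≤ C ∧ c ≤ C :=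
  ⟨max 1 c.toNNReal, le_max_left _ _, by
    rw [ENNReal.coe_max, ENNReal.coe_toNNReal hc]
    exact le_max_right _ _⟩

lemma axiomQ1_wienerNorm (hp : p ≠ 0) (hq : q ≠ 0) : AxiomQ1 (wienerNorm p q) := by
  obtain ⟨C, hC, hle⟩ :=
    exists_one_le_coe_ge (ENNReal.mul_lt_top p.LpAddConst_lt_top q.LpAddConst_lt_top).ne
  exact ⟨homogeneous_wienerNorm hq, definite_wienerNorm hp hq, C, hC, fun f g hf hg =>
    (wienerNorm_lift_add_le hq hf hg).trans (by gcongr)⟩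

lemma axiomP1_wienerNorm (hp : 1 ≤ p) (hq : 1 ≤ q) : AxiomP1 (wienerNorm p q) := by
  have hq0 : q ≠ 0 := (one_pos.trans_le hq).ne'
  refine ⟨homogeneous_wienerNorm hq0, definite_wienerNorm (one_pos.trans_le hp).ne' hq0,
    fun f g hf hg => ?_⟩
  simpa only [ENNReal.LpAddConst_of_one_le hp, ENNReal.LpAddConst_of_one_le hq, one_mul] using
    wienerNorm_lift_add_le (p := p) hq0 hf hg

lemma axiomP2_wienerNorm (hq : q ≠ 0) : AxiomP2 (wienerNorm p q) := fun f g _ _ h => by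
  simpa only [wienerNorm_lift hq] using mixedNorm_mono (by rwa [sum_cell])

lemma axiomP3_wienerNorm (hq : q ≠ 0) : AxiomP3 (wienerNorm p q) := fun F f hF _ h => by
  simp only [wienerNorm_lift hq]
  refine monotone_and_tendsto_iff.2 ⟨fun m n hmn => mixedNorm_mono ?_,
    mixedNorm_iSup_of_monotone (by rwa [sum_cell]) ?_⟩
  · rw [sum_cell]
    exact h.mono fun t ht => ht.1 hmn
  · rw [sum_cell]
    exact h.mono fun t ht => monotone_and_tendsto_iff.1 ht

lemma dilationBounded_wienerNorm (hq : q ≠ 0) : DilationBounded (wienerNorm p q) := by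
  have hK : (2 ^ (1 / p).toReal * 2 ^ (1 / q).toReal : ℝ≥0∞) ≠ ⊤ :=
    ENNReal.mul_ne_top (ENNReal.rpow_ne_top_of_nonneg ENNReal.toReal_nonneg ENNReal.ofNat_ne_top)
      (ENNReal.rpow_ne_top_of_nonneg ENNReal.toReal_nonneg ENNReal.ofNat_ne_top)
  refine ⟨(2 ^ (1 / p).toReal * 2 ^ (1 / q).toReal : ℝ≥0∞).toNNReal, fun g hg => ?_⟩
  rw [wienerNorm_lift hq, wienerNorm_lift hq, ENNReal.coe_toNNReal hK]
  exact mixedNorm_cell_comp_half_le hg p q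

lemma wienerNorm_indicator_Iio_lt_top (hp : p ≠ 0) (hq : q ≠ 0) (a : ℝ≥0) :
    wienerNorm p q (lift ((Set.Iio a).indicator fun _ => 1)) < ⊤ := by
  have eq_zero_of_ceil_le (t : ℝ≥0) (ht : (⌈a⌉₊ : ℝ≥0) ≤ t) :
      (Set.Iio a).indicator (fun _ => (1 : ℝ≥0∞)) t = 0 :=
    Set.indicator_of_notMem (Set.notMem_Iio.2 ((Nat.le_ceil a).trans ht)) _
  rw [wienerNorm_lift hq, mixedNorm_cell_lt_top_iff_of_bounded_support hp hq eq_zero_of_ceil_le]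
  exact eLpNorm_indicator_one_lt_top (lam_Iio a ▸ ENNReal.coe_lt_top) p

theorem isQuasiBanachFunctionNorm_rearranged_wienerNorm (hp : p ≠ 0) (hq : q ≠ 0) :
    IsQuasiBanachFunctionNorm (rearranged (wienerNorm p q)) :=
  isQuasiBanachFunctionNorm_rearranged (axiomQ1_wienerNorm hp hq) (axiomP2_wienerNorm hq)
    (axiomP3_wienerNorm hq) (wienerNorm_indicator_Iio_lt_top hp hq) (dilationBounded_wienerNorm hq)

end wienerNorm

/-! ### Equivalence of functionals -/

section EquivalentFunctionals

variable {N₁ N₂ : Functional}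

lemma equivalentFunctionals_iff : EquivalentFunctionals N₁ N₂ ↔
    ∃ C : ℝ≥0, ∀ f, MemM f → N₁ f ≤ C * N₂ f ∧ N₂ f ≤ C * N₁ f := by
  have inv_mul_le_iff {C : ℝ≥0} (hC : 0 < C) (x y : ℝ≥0∞) :
      (C : ℝ≥0∞)⁻¹ * x ≤ y ↔ x ≤ C * y :=
    ENNReal.inv_mul_le_iff (ENNReal.coe_ne_zero.2 hC.ne') ENNReal.coe_ne_top
  constructor
  · rintro ⟨C, hC, h⟩
    exact ⟨C, fun f hf => ⟨(inv_mul_le_iff hC _ _).1 (h f hf).1, (h f hf).2⟩⟩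
  · rintro ⟨C, h⟩
    refine ⟨C + 1, by positivity, fun f hf => ⟨(inv_mul_le_iff (by positivity) _ _).2 ?_, ?_⟩⟩
    · exact (h f hf).1.trans (by gcongr; simp)
    · exact (h f hf).2.trans (by gcongr; simp)

lemma EquivalentFunctionals.refl (N : Functional) : EquivalentFunctionals N N :=
  equivalentFunctionals_iff.2 ⟨1, fun _ _ => by simp⟩

lemma EquivalentFunctionals.lt_top_iff (h : EquivalentFunctionals N₁ N₂) {f : ℝ≥0 → ExtComplex}
    (hf : MemM f) : N₁ f < ⊤ ↔ N₂ f < ⊤ := by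
  obtain ⟨C, hC⟩ := equivalentFunctionals_iff.1 h
  exact ⟨fun h₁ => (hC f hf).2.trans_lt (ENNReal.mul_lt_top ENNReal.coe_lt_top h₁),
    fun h₂ => (hC f hf).1.trans_lt (ENNReal.mul_lt_top ENNReal.coe_lt_top h₂)⟩

end EquivalentFunctionals

variable {p q : ℝ≥0∞}

theorem equivalentFunctionals_rearranged_wienerNorm_wienerLuxemburg (hp : p ≠ 0) (hq : q ≠ 0) :
    EquivalentFunctionals (rearranged (wienerNorm p q))
      (wienerLuxemburg (lebesgueNorm p) (lebesgueNorm q)) := by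
  have add_sq_ne_top : (q.LpAddConst + q.LpAddConst ^ 2 : ℝ≥0∞) ≠ ⊤ :=
    ENNReal.add_ne_top.2 ⟨q.LpAddConst_lt_top.ne, ENNReal.pow_ne_top q.LpAddConst_lt_top.ne⟩
  obtain ⟨C, -, hC⟩ :=
    exists_one_le_coe_ge (max_lt add_sq_ne_top.lt_top (ENNReal.ofNat_lt_top (n := 2))).ne
  refine equivalentFunctionals_iff.2 ⟨C, fun f _ => ?_⟩
  rw [rearranged_eq, wienerNorm_lift hq, wienerLuxemburg]
  simp only [lebesgueNorm, absFun_lift, rearrangement_eq_decreasingRearrangement]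
  constructor
  · exact (mixedNorm_cell_le_of_antitone antitone_decreasingRearrangement hp hq).trans
      (by gcongr; exact (le_max_left _ _).trans hC)
  · exact (le_mixedNorm_cell_of_antitone antitone_decreasingRearrangement hp hq).trans
      (by gcongr; exact (le_max_right _ _).trans hC)

/-! ### Equal exponents -/

lemma wienerNorm_self (hp : p ≠ 0) (f : ℝ≥0 → ExtComplex) :
    wienerNorm p p f = lebesgueNorm p f := by
  rw [wienerNorm_eq_mixedNorm hp, mixedNorm_self, sum_cell, lebesgueNorm]

lemma rearrangementInvariant_lebesgueNorm (p : ℝ≥0∞) : RearrangementInvariant (lebesgueNorm p) :=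
  fun _ _ hf hg h => eLpNorm_eq_of_measure_lt_eq hf.aemeasurable_absFun hg.aemeasurable_absFun h p

lemma axiomP4_lebesgueNorm (p : ℝ≥0∞) : AxiomP4 (lebesgueNorm p) := fun E _ hE => by
  rw [lebesgueNorm, absFun_lift]
  exact eLpNorm_indicator_one_lt_top hE p

lemma axiomP5_lebesgueNorm (hp : 1 ≤ p) : AxiomP5 (lebesgueNorm p) := fun E _ hE => by
  have exponent_nonneg : 0 ≤ 1 / (1 : ℝ≥0∞).toReal - 1 / p.toReal := by
    rcases hp.eq_or_lt with rfl | hp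
    · simp
    · exact sub_nonneg.2 (one_div_toReal_lt_one_div_toReal one_ne_zero hp).le
  have rpow_ne_top := ENNReal.rpow_ne_top_of_nonneg exponent_nonneg hE.ne
  refine ⟨(lam E ^ (1 / (1 : ℝ≥0∞).toReal - 1 / p.toReal)).toNNReal, fun f hf => ?_⟩
  rw [ENNReal.coe_toNNReal rpow_ne_top, lebesgueNorm, absFun_lift]
  calc ∫⁻ t in E, f t ∂lam = eLpNorm f 1 (lam.restrict E) := by
        simp only [eLpNorm_one_eq_lintegral_enorm, enorm_eq_self]
    _ ≤ eLpNorm f p (lam.restrict E) * lam E ^ (1 / (1 : ℝ≥0∞).toReal - 1 / p.toReal) := by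
        simpa only [Measure.restrict_apply_univ] using
          eLpNorm_le_eLpNorm_mul_rpow_measure_univ hp hf.restrict.aestronglyMeasurable
    _ ≤ _ := by
        rw [mul_comm]
        gcongr
        exact Measure.restrict_le_self

theorem isBanachFunctionNorm_wienerNorm_self (hp : 1 ≤ p) :
    IsBanachFunctionNorm (wienerNorm p p) := by
  have hp0 : p ≠ 0 := (one_pos.trans_le hp).ne'
  have wienerNorm_eq : wienerNorm p p = lebesgueNorm p := funext (wienerNorm_self hp0)
  exact ⟨absInvariant_wienerNorm hp0, axiomP1_wienerNorm hp hp, axiomP2_wienerNorm hp0,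
    axiomP3_wienerNorm hp0, wienerNorm_eq ▸ axiomP4_lebesgueNorm p,
    wienerNorm_eq ▸ axiomP5_lebesgueNorm hp⟩

lemma rearrangementInvariant_wienerNorm_self (hp : p ≠ 0) :
    RearrangementInvariant (wienerNorm p p) :=
  funext (wienerNorm_self hp) ▸ rearrangementInvariant_lebesgueNorm p

/-! ### Different exponents -/

theorem not_axiomP4_wienerNorm (hq : q ≠ 0) (h : q < p) : ¬ AxiomP4 (wienerNorm p q) := fun h4 => by
  obtain ⟨E, hE, hE_fin, hE_top⟩ := exists_mixedNorm_indicator_one_eq_top hq h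
  have norm_lt_top := h4 E hE.nullMeasurableSet hE_fin
  rw [wienerNorm_lift hq, hE_top] at norm_lt_top
  exact norm_lt_top.ne rfl

theorem not_axiomP5_wienerNorm (hp : p ≠ 0) (h : p < q) : ¬ AxiomP5 (wienerNorm p q) := fun h5 => by
  obtain ⟨g, hg, hg_supp, hg_fin, hg_top⟩ :=
    exists_mixedNorm_lt_top_eLpNorm_eq_top hp h one_ne_zero ENNReal.one_ne_top
  obtain ⟨C, hC⟩ := h5 g.support (measurableSet_support hg).nullMeasurableSet hg_supp
  have integral_le := hC g hg.aemeasurable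
  rw [wienerNorm_lift (bot_lt_of_lt h).ne', setLIntegral_eq_of_support_subset subset_rfl]
    at integral_le
  rw [eLpNorm_one_eq_lintegral_enorm] at hg_top
  simp only [enorm_eq_self] at hg_top
  exact (integral_le.trans_lt (ENNReal.mul_lt_top ENNReal.coe_lt_top hg_fin)).ne hg_top

lemma mixedNorm_cell_lt_top_iff_of_equivalentFunctionals (hp : p ≠ 0) (hq : q ≠ 0)
    {N : Functional} (hN : RearrangementInvariant N)
    (h : EquivalentFunctionals (wienerNorm p q) N) {g : ℝ≥0 → ℝ≥0∞} (hg : AEMeasurable g lam)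
    (hsupp : lam g.support < ⊤) : mixedNorm cell p q g < ⊤ ↔ eLpNorm g p lam < ⊤ := by
  have memM_g := memM_lift hg
  have memM_g_star : MemM (lift (decreasingRearrangement lam g)) :=
    memM_lift measurable_decreasingRearrangement.aemeasurable
  have equimeasurable : Equimeasurable (lift g) (lift (decreasingRearrangement lam g)) :=
    fun s => by
      simpa only [distribution, absFun_lift] using (lam_lt_decreasingRearrangement lam g s).symm
  calc mixedNorm cell p q g < ⊤
      ↔ N (lift g) < ⊤ := by rw [← wienerNorm_lift hq, h.lt_top_iff memM_g]
    _ ↔ N (lift (decreasingRearrangement lam g)) < ⊤ := by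
        rw [hN _ _ memM_g memM_g_star equimeasurable]
    _ ↔ mixedNorm cell p q (decreasingRearrangement lam g) < ⊤ := by
        rw [← h.lt_top_iff memM_g_star, wienerNorm_lift hq]
    _ ↔ eLpNorm g p lam < ⊤ := mixedNorm_cell_decreasingRearrangement_lt_top_iff hg hsupp hp hq

theorem eq_of_equivalentFunctionals_wienerNorm (hp : p ≠ 0) (hq : q ≠ 0) {N : Functional}
    (hN : RearrangementInvariant N) (h : EquivalentFunctionals (wienerNorm p q) N) : p = q := by
  rcases lt_trichotomy p q with hpq | hpq | hqp
  · obtain ⟨g, hg, hg_supp, hg_fin, hg_top⟩ :=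
      exists_mixedNorm_lt_top_eLpNorm_eq_top hp hpq hp hpq.ne_top
    exact absurd hg_top ((mixedNorm_cell_lt_top_iff_of_equivalentFunctionals hp hq hN h
      hg.aemeasurable hg_supp).1 hg_fin).ne
  · exact hpq
  · obtain ⟨E, hE, hE_fin, hE_top⟩ := exists_mixedNorm_indicator_one_eq_top hq hqp
    exact absurd hE_top ((mixedNorm_cell_lt_top_iff_of_equivalentFunctionals hp hq hN h
      (aemeasurable_const.indicator hE)
      ((measure_mono Set.support_indicator_subset).trans_lt hE_fin)).2
        (eLpNorm_indicator_one_lt_top hE_fin p)).ne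

/-! ### Exponents below one -/

lemma mixedNorm_cell_comp_floor (hp : p ≠ 0) (q : ℝ≥0∞) (b : ℕ → ℝ≥0∞) :
    mixedNorm cell p q (fun t => b ⌊t⌋₊) = eLpNorm b q Measure.count := by
  have eLpNorm_cell (n : ℕ) : eLpNorm (fun t : ℝ≥0 => b ⌊t⌋₊) p (cell n) = b n := by
    rw [← eLpNorm_const_of_isProbabilityMeasure (μ := cell n) hp (b n)]
    refine eLpNorm_congr_ae (ae_cell fun t hnt htn => ?_)
    exact congrArg b ((Nat.floor_eq_iff zero_le).2 ⟨hnt, htn⟩)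
  simp only [mixedNorm, eLpNorm_cell]

lemma aemeasurable_comp_floor (b : ℕ → ℝ≥0∞) : AEMeasurable (fun t : ℝ≥0 => b ⌊t⌋₊) lam :=
  ((measurable_of_countable b).comp Nat.measurable_floor).aemeasurable

lemma wienerNorm_lift_indicator_floor (hp : p ≠ 0) (hq0 : q ≠ 0) (hq : q ≠ ⊤) (s : Set ℕ) :
    wienerNorm p q (lift fun t => s.indicator (fun _ => 1) ⌊t⌋₊) =
      Measure.count s ^ (1 / q.toReal) := by
  rw [wienerNorm_lift hq0, mixedNorm_cell_comp_floor hp,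
    eLpNorm_indicator_const (Set.to_countable s).measurableSet hq0 hq, enorm_eq_self, one_mul]

lemma apply_lift_indicator_floor_le {N : Functional} (hN : AxiomP1 N) {C : ℝ≥0∞}
    (hC : ∀ n : ℕ, N (lift fun t => ({n} : Set ℕ).indicator (fun _ => 1) ⌊t⌋₊) ≤ C) (n : ℕ) :
    N (lift fun t => (Set.Iio n).indicator (fun _ => 1) ⌊t⌋₊) ≤ n * C := by
  induction n with
  | zero => simp [(hN.definite _ aemeasurable_const).2 (ae_of_all _ fun _ => rfl)]
  | succ n ih =>
    have indicator_succ (k : ℕ) : (Set.Iio (n + 1)).indicator (fun _ => (1 : ℝ≥0∞)) k =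
        (Set.Iio n).indicator (fun _ => 1) k + ({n} : Set ℕ).indicator (fun _ => 1) k := by
      rw [← Order.succ_eq_add_one, Order.Iio_succ_eq_insert, Set.insert_eq, Set.union_comm,
        Set.indicator_union_of_disjoint (by simp)]
    simp only [indicator_succ]
    refine (hN.subadditive _ _ (aemeasurable_comp_floor _) (aemeasurable_comp_floor _)).trans ?_
    rw [Nat.cast_succ, add_one_mul]
    exact add_le_add ih (hC n)

lemma exists_mul_lt_natCast_rpow {x : ℝ} (hx : 1 < x) (D : ℝ≥0) :
    ∃ n : ℕ, (D : ℝ≥0∞) * n < (n : ℝ≥0∞) ^ x := by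
  obtain ⟨n, hDn, hn⟩ := ((((NNReal.tendsto_rpow_atTop (sub_pos.2 hx)).comp
    tendsto_natCast_atTop_atTop).eventually_gt_atTop D).and (eventually_gt_atTop 0)).exists
  have cast_pos : 0 < (n : ℝ≥0) := Nat.cast_pos.2 hn
  refine ⟨n, ?_⟩
  rw [Function.comp_apply, NNReal.rpow_sub_one cast_pos.ne', lt_div_iff₀ cast_pos] at hDn
  rw [← ENNReal.coe_natCast, ← ENNReal.coe_rpow_of_ne_zero cast_pos.ne']
  exact_mod_cast hDn

/- The indicators of `n` unit cells have norm `1` and their sum has norm `n ^ (1 / q)`, which for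
`q < 1` outgrows `n`. -/
theorem one_le_of_equivalentFunctionals_wienerNorm (hp : p ≠ 0) (hq : q ≠ 0) {N : Functional}
    (hN : AxiomP1 N) (h : EquivalentFunctionals (wienerNorm p q) N) : 1 ≤ q := by
  by_contra! hq1
  have one_lt_exponent : 1 < 1 / q.toReal := by
    simpa using one_div_toReal_lt_one_div_toReal hq hq1
  obtain ⟨C, hC⟩ := equivalentFunctionals_iff.1 h
  obtain ⟨n, hn⟩ := exists_mul_lt_natCast_rpow one_lt_exponent (C * C)
  refine hn.not_ge ?_
  have memM_floor (s : Set ℕ) : MemM (lift fun t => s.indicator (fun _ => 1) ⌊t⌋₊) :=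
    memM_lift (aemeasurable_comp_floor _)
  have singleton_le (k : ℕ) :
      N (lift fun t => ({k} : Set ℕ).indicator (fun _ => 1) ⌊t⌋₊) ≤ C := by
    simpa only [wienerNorm_lift_indicator_floor hp hq hq1.ne_top, Measure.count_singleton,
      ENNReal.one_rpow, mul_one] using (hC _ (memM_floor {k})).2
  calc (n : ℝ≥0∞) ^ (1 / q.toReal)
      = wienerNorm p q (lift fun t => (Set.Iio n).indicator (fun _ => 1) ⌊t⌋₊) := by
        rw [wienerNorm_lift_indicator_floor hp hq hq1.ne_top, ← Finset.coe_Iio,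
          Measure.count_apply_finset, Nat.card_Iio]
    _ ≤ C * N (lift fun t => (Set.Iio n).indicator (fun _ => 1) ⌊t⌋₊) := (hC _ (memM_floor _)).1
    _ ≤ C * (n * C) := by
        gcongr
        exact apply_lift_indicator_floor_le hN singleton_le n
    _ = (C * C : ℝ≥0) * n := by
        push_cast
        ring

theorem isBanachFunctionNorm_wienerNorm_iff (hp : p ≠ 0) (hq : q ≠ 0) :
    IsBanachFunctionNorm (wienerNorm p q) ↔ p = q ∧ 1 ≤ p := by
  refine ⟨fun h => ?_, ?_⟩
  · have exponents_eq : p = q := le_antisymm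
      (not_lt.1 fun hqp => not_axiomP4_wienerNorm hq hqp h.p4)
      (not_lt.1 fun hpq => not_axiomP5_wienerNorm hp hpq h.p5)
    exact ⟨exponents_eq, exponents_eq ▸
      one_le_of_equivalentFunctionals_wienerNorm hp hq h.p1 (.refl _)⟩
  · rintro ⟨rfl, hp1⟩
    exact isBanachFunctionNorm_wienerNorm_self hp1

theorem eq_and_one_le_of_equivalentFunctionals_wienerNorm (hp : p ≠ 0) (hq : q ≠ 0)
    {N : Functional} (hN1 : AxiomP1 N) (hN : RearrangementInvariant N)
    (h : EquivalentFunctionals (wienerNorm p q) N) : p = q ∧ 1 ≤ p := by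
  obtain rfl := eq_of_equivalentFunctionals_wienerNorm hp hq hN h
  exact ⟨rfl, one_le_of_equivalentFunctionals_wienerNorm hp hp hN1 h⟩

theorem exists_isBanachFunctionNorm_equivalent_of_one_le (hp : 1 ≤ p) :
    ∃ N : Functional, IsBanachFunctionNorm N ∧ RearrangementInvariant N ∧
      EquivalentFunctionals (wienerNorm p p) N :=
  ⟨wienerNorm p p, isBanachFunctionNorm_wienerNorm_self hp,
    rearrangementInvariant_wienerNorm_self (one_pos.trans_le hp).ne', .refl _⟩

end WienerLuxemburg

theorem mainTheorem12_general (p q : ℝ≥0∞) (hp : p ≠ 0) (hq : q ≠ 0) :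
    (IsQuasiBanachFunctionNorm (rearranged (wienerNorm p q)) ∧
      RearrangementInvariant (rearranged (wienerNorm p q))) ∧
    EquivalentFunctionals (rearranged (wienerNorm p q))
      (wienerLuxemburg (lebesgueNorm p) (lebesgueNorm q)) ∧
    (q < p → ¬ AxiomP4 (wienerNorm p q)) ∧
    (p < q → ¬ AxiomP5 (wienerNorm p q)) ∧
    (IsBanachFunctionNorm (wienerNorm p q) ↔ p = q ∧ 1 ≤ p) ∧
    ((∃ N : Functional, AbsInvariant N ∧ AxiomP1 N ∧ RearrangementInvariant N ∧
      EquivalentFunctionals (wienerNorm p q) N) ↔ p = q ∧ 1 ≤ p) ∧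
    ((∃ N : Functional, IsBanachFunctionNorm N ∧ RearrangementInvariant N ∧
      EquivalentFunctionals (wienerNorm p q) N) ↔ p = q ∧ 1 ≤ p) ∧
    (p = q → ∀ f : ℝ≥0 → ExtComplex, MemM f → wienerNorm p q f = lebesgueNorm p f) := by
  refine ⟨⟨isQuasiBanachFunctionNorm_rearranged_wienerNorm hp hq,
    rearrangementInvariant_rearranged _⟩,
    equivalentFunctionals_rearranged_wienerNorm_wienerLuxemburg hp hq,
    not_axiomP4_wienerNorm hq, not_axiomP5_wienerNorm hp,
    isBanachFunctionNorm_wienerNorm_iff hp hq, ⟨?_, ?_⟩, ⟨?_, ?_⟩, ?_⟩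
  · rintro ⟨N, -, hN1, hN, h⟩
    exact eq_and_one_le_of_equivalentFunctionals_wienerNorm hp hq hN1 hN h
  · rintro ⟨rfl, hp1⟩
    obtain ⟨N, hB, hN, h⟩ := exists_isBanachFunctionNorm_equivalent_of_one_le hp1
    exact ⟨N, hB.abs_invariant, hB.p1, hN, h⟩
  · rintro ⟨N, hB, hN, h⟩
    exact eq_and_one_le_of_equivalentFunctionals_wienerNorm hp hq hB.p1 hN h
  · rintro ⟨rfl, hp1⟩
    exact exists_isBanachFunctionNorm_equivalent_of_one_le hp1
  · rintro rfl f -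
    exact wienerNorm_self hp f

theorem mainTheorem12 (p q : ℝ≥0∞) (hp : 1 ≤ p) (hq : 1 ≤ q) :
    -- `f ↦ ‖f*‖_{W(L^p, l^q)}` is an r.i. quasi-Banach function norm,
    (IsQuasiBanachFunctionNorm (rearranged (wienerNorm p q)) ∧
      RearrangementInvariant (rearranged (wienerNorm p q))) ∧
    -- equivalent to the Wiener–Luxemburg quasinorm
    EquivalentFunctionals (rearranged (wienerNorm p q))
      (wienerLuxemburg (lebesgueNorm p) (lebesgueNorm q)) ∧
    -- failure of (P4) and (P5) for the Wiener norm
    (q < p → ¬ AxiomP4 (wienerNorm p q)) ∧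
    (p < q → ¬ AxiomP5 (wienerNorm p q)) ∧
    (IsBanachFunctionNorm (wienerNorm p q) ↔ p = q) ∧
    -- equivalence to an r.i. norm, for norms in the sense of (P1) and for Banach function norms
    ((∃ N : Functional, AbsInvariant N ∧ AxiomP1 N ∧ RearrangementInvariant N ∧
      EquivalentFunctionals (wienerNorm p q) N) ↔ p = q) ∧
    ((∃ N : Functional, IsBanachFunctionNorm N ∧ RearrangementInvariant N ∧
      EquivalentFunctionals (wienerNorm p q) N) ↔ p = q) ∧
    -- for `p = q` it is the Lebesgue norm
    (p = q → ∀ f : ℝ≥0 → ExtComplex, MemM f → wienerNorm p q f = lebesgueNorm p f) := by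
  simpa only [hp, and_true] using
    mainTheorem12_general p q (one_pos.trans_le hp).ne' (one_pos.trans_le hq).ne'
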